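/- **Definitions.** A point of $\mathbb Z^3$ is even or odd according to the parity of its coordinate sum. A dimer tiling $\tau$ of $\mathbb Z^3$ is a perfect matching of the nearest-neighbour graph on $\mathbb Z^3$; $\Omega$ is the set of dimer tilings. For $\tau\in\Omega$ let $v_\tau(e)=1$ if $e\in\tau$ and $v_\tau(e)=0$ if $e\notin\tau$, for each edge $e$ oriented from even to odd. For a flat surface $S\subset\mathbb R^3$ with unit normal $\xi$, let $$\mathrm{flux}(v_\tau,S)=\sum_{e\cap S\neq\emptyset}\mathrm{sign}\langle \xi,e\rangle\, v_\tau(e),$$ the sum running over the edges $e$ of $\mathbb Z^3$ that meet $S$, oriented from even to odd. Let $\mathcal O=\{s\in\mathbb R^3: |s_1|+|s_2|+|s_3|\le 1\}$. For $r\in\mathbb R$ let $B_r=[-r,r]^3\cap\mathbb Z^3$ (empty if $r<0$). Viewing lattice points as unit cubes, for $n\in\mathbb N$ the boundary $\partial B_n$ is the boundary of $[-n-\tfrac12,n+\tfrac12]^3$. An $\epsilon$ patch on $\partial B_n$ is an axis-parallel $\epsilon n\times\epsilon n$ square $\alpha$ contained in a face of $\partial B_n$; $\xi_\alpha$ is its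 outward unit normal. A tiling $\tau\in\Omega$ is *$\epsilon$-nearly-constant with value $s$* if $$\mathrm{flux}(v_\tau,\alpha)=\tfrac12\langle\xi_\alpha,s\rangle\,\epsilon^2n^2+o(\epsilon^2n^2)\qquad(n\to\infty),$$ uniformly over all $\epsilon$ patches $\alpha$ on $\partial B_n$. That is, for every $\eta>0$ there is $M$ such that $|\mathrm{flux}(v_\tau,\alpha)-\tfrac12\langle\xi_\alpha,s\rangle\epsilon^2n^2|\le\eta\,\epsilon^2n^2$ for all $n>M$ and all $\epsilon$ patches $\alpha$ on $\partial B_n$. For $\delta>0$ let $A_n=B_n\setminus B_{(1-\delta)n}$. For $\tau_1,\tau_2\in\Omega$, we say that *$A_n$ can be tiled with outer boundary condition $\tau_1$ and inner boundary condition $\tau_2$* if the nearest-neighbour graph on the set of those points of $A_n$ that are neither matched by $\tau_1$ to a point outside $B_n$ nor matched by $\tau_2$ to a point of $B_{(1-\delta)n}$ has a perfect matching. **Theorem (patching).** Let $\delta>0$ and $s\in\mathrm{Int}(\mathcal O)$. There is $\epsilon_0=\epsilon_0(\delta,s)>0$ such that for every $\epsilon\in(0,\epsilon_0)$ and all $\tau_1,\tau_2\in\Omega$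 that are $\epsilon$-nearly-constant with value $s$, there is $N$ such that for all $n\ge N$ the annulus $A_n$ can be tiled with outer boundary condition $\tau_1$ and inner boundary condition $\tau_2$. -/

import Mathlib

namespace Dimer

noncomputable section

/-- Points of the lattice `ℤ³`. -/
abbrev Vertex : Type := Fin 3 → ℤ

/-- The nearest-neighbour graph on `ℤ³`. -/
def cubicLattice : SimpleGraph Vertex where
  Adj x y := ∑ i, |x i - y i| = 1
  symm := ⟨fun x y h => by simpa only [abs_sub_comm] using h⟩
  loopless := ⟨fun x h => by simp at h⟩

/-- A lattice point is even if the sum of its coordinates is even. -/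
def IsEven (x : Vertex) : Prop := Even (∑ i, x i)

/-- The space `Ω` of dimer tilings of `ℤ³`, i.e. of perfect matchings of the lattice. -/
abbrev DimerTiling : Type := {τ : cubicLattice.Subgraph // τ.IsPerfectMatching}

/-- The mean current octahedron `𝒪 = {s ∈ ℝ³ : |s₁| + |s₂| + |s₃| ≤ 1}`. -/
def meanCurrentOctahedron : Set (Fin 3 → ℝ) := {s | ∑ i, |s i| ≤ 1}

/-- A lattice point viewed in `ℝ³`. -/
def toReal (x : Vertex) : Fin 3 → ℝ := fun i => (x i : ℝ)

open Classical in
/-- The pretiling flow `v_τ`, as a function of oriented edges: `+1` on the tiles of `τ` oriented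
from even to odd, `-1` on the tiles oriented from odd to even, `0` on all other edges. -/
def pretilingFlow (τ : DimerTiling) (x y : Vertex) : ℝ :=
  if τ.1.Adj x y then (if IsEven x then 1 else -1) else 0

/-- The edges of `ℤ³`, oriented from even to odd, that meet a set `S ⊆ ℝ³`. -/
def edgesMeeting (S : Set (Fin 3 → ℝ)) : Set (Vertex × Vertex) :=
  {e | IsEven e.1 ∧ cubicLattice.Adj e.1 e.2 ∧
    (segment ℝ (toReal e.1) (toReal e.2) ∩ S).Nonempty}

/-- Only finitely many edges meet a bounded set, so that the sum defining the flux through a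
bounded surface is a finite sum. -/
theorem edgesMeeting_finite {S : Set (Fin 3 → ℝ)} (hS : Bornology.IsBounded S) :
    (edgesMeeting S).Finite := by
  obtain ⟨r, hr⟩ := hS.exists_norm_le
  obtain ⟨k, hk⟩ := exists_nat_ge (r + 1)
  have hfin : (Set.Icc (fun _ => -(k : ℤ)) (fun _ => (k : ℤ)) : Set Vertex).Finite :=
    Set.finite_Icc _ _
  refine (hfin.prod hfin).subset ?_
  rintro ⟨x, y⟩ ⟨-, hadj, p, ⟨a, b, ha, hb, hab, rfl⟩, hpS⟩
  have hadj' : ∑ i, |x i - y i| = 1 := hadj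
  have hxy : ∀ i, |(x i : ℝ) - y i| ≤ 1 := by
    intro i
    have h : |x i - y i| ≤ 1 := by
      rw [← hadj']
      exact Finset.single_le_sum (f := fun i => |x i - y i|) (fun j _ => abs_nonneg _)
        (Finset.mem_univ i)
    exact_mod_cast h
  have hp : ∀ i, |a * (x i : ℝ) + b * y i| ≤ r := fun i =>
    (norm_le_pi_norm (a • toReal x + b • toReal y) i).trans (hr _ hpS)
  have key : ∀ i, (|(x i : ℝ)| ≤ k) ∧ (|(y i : ℝ)| ≤ k) := by
    intro i
    have h1 := abs_le.1 (hxy i)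
    have h2 := abs_le.1 (hp i)
    have ea : a = 1 - b := by linarith
    subst ea
    refine ⟨abs_le.2 ⟨?_, ?_⟩, abs_le.2 ⟨?_, ?_⟩⟩ <;> nlinarith
  have key' : ∀ i, |x i| ≤ (k : ℤ) ∧ |y i| ≤ (k : ℤ) := fun i =>
    ⟨by exact_mod_cast (key i).1, by exact_mod_cast (key i).2⟩
  exact ⟨⟨fun i => (abs_le.1 (key' i).1).1, fun i => (abs_le.1 (key' i).1).2⟩,
    ⟨fun i => (abs_le.1 (key' i).2).1, fun i => (abs_le.1 (key' i).2).2⟩⟩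

/-- The flux of a discrete vector field `v` through a bounded flat surface `S` with unit normal
vector `ξ`: the sum of `sign ⟨ξ, e⟩ v(e)` over the edges `e`, oriented from even to odd, that
meet `S`. -/
def flux (v : Vertex → Vertex → ℝ) (S : Set (Fin 3 → ℝ)) (ξ : Fin 3 → ℝ) : ℝ :=
  ∑ᶠ (e : Vertex × Vertex) (_ : e ∈ edgesMeeting S),
    (SignType.sign (ξ ⬝ᵥ (toReal e.2 - toReal e.1)) : ℝ) * v e.1 e.2

/-- `α` is an `ε` patch on `∂B_n`, with outward unit normal `ξ`. A lattice point stands for the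
unit cube centred at it, so that `B_n` occupies `[-n - 1/2, n + 1/2]³`, whose boundary is made
of squares of the lattice `(1/2, 1/2, 1/2) + ℤ³`; its face with outward normal `σ ηᵢ`
(`σ = ±1`) lies in the plane `xᵢ = σ (n + 1/2)`. -/
def IsPatch (ε : ℝ) (n : ℕ) (α : Set (Fin 3 → ℝ)) (ξ : Fin 3 → ℝ) : Prop :=
  ∃ (i : Fin 3) (σ : ℝ) (c : Fin 3 → ℝ), (σ = 1 ∨ σ = -1) ∧ ξ = Pi.single i σ ∧
    (∀ j, j ≠ i → -((n : ℝ) + 1 / 2) ≤ c j ∧ c j + ε * n ≤ (n : ℝ) + 1 / 2) ∧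
    α = {x | x i = σ * ((n : ℝ) + 1 / 2) ∧ ∀ j, j ≠ i → c j ≤ x j ∧ x j ≤ c j + ε * n}

/-- `τ` is `ε`-nearly-constant with value `s`: the flux of `v_τ` through every `ε` patch `α` on
`∂B_n` is `½ ⟨ξ_α, s⟩ ε² n² + o(ε² n²)` as `n → ∞`, uniformly in the patch. -/
def NearlyConstant (ε : ℝ) (s : Fin 3 → ℝ) (τ : DimerTiling) : Prop :=
  ∀ η : ℝ, 0 < η → ∃ M : ℕ, ∀ n : ℕ, M < n → ∀ (α : Set (Fin 3 → ℝ)) (ξ : Fin 3 → ℝ),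
    IsPatch ε n α ξ →
      |flux (pretilingFlow τ) α ξ - 1 / 2 * (ξ ⬝ᵥ s) * (ε ^ 2 * (n : ℝ) ^ 2)|
        ≤ η * (ε ^ 2 * (n : ℝ) ^ 2)

/-- The lattice points of the box `B_r = [-r, r]³` (empty if `r < 0`). -/
def box (r : ℝ) : Set Vertex := {x | ∀ i, |(x i : ℝ)| ≤ r}

/-- The annulus `A_n = B_n \ B_{(1-δ)n}` with outer boundary condition `τ₁` and inner boundary
condition `τ₂`: the points of `A_n` that `τ₁` does not match to a point outside `B_n` and that
`τ₂` does not match to a point of `B_{(1-δ)n}`. -/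
def annulusWithBoundary (δ : ℝ) (n : ℕ) (τ₁ τ₂ : DimerTiling) : Set Vertex :=
  {x | x ∈ box n \ box ((1 - δ) * n) ∧ (∀ y, τ₁.1.Adj x y → y ∈ box n) ∧
    (∀ y, τ₂.1.Adj x y → y ∉ box ((1 - δ) * n))}

/-- A region of `ℤ³` can be tiled by dimers if its points admit a perfect matching by lattice
edges joining two points of the region. -/
def Tileable (R : Set Vertex) : Prop :=
  ∃ M : cubicLattice.Subgraph, M.verts = R ∧ M.IsMatching

end

end Dimer

/-! Suppose the annulus region cannot be tiled. By Hall's theorem some set `U` of points of one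
parity has a neighbour set `N` in the region with fewer points than `U`; put `V = U ∪ N`. For radii
`kin < kout` inside the annulus, form a hybrid edge weighting: `τ₁` on edges touching the outside of
the ball of radius `kout`, `τ₂` on edges touching the ball of radius `kin`, and in between the
uniform fractional matching `w` of mean current `s`. Since `s` is interior, `w` is at least some `c
> 0` on every edge. No hybrid weight leaves `V` from `U`, while every edge leaving `V` from `N` in
the middle carries at least `c`. The divergence theorem (`imbalance_le`) then gives: `1 + c *`
(length of the boundary of `V` in the shells between) is at most the flux mismatch between `w` and
the tilings, summed over `V` on the two bounding spheres.

The mismatch on one sphere has three bounds in terms of the perimeter `p` of `V` in the shell: order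
`n²` trivially; order `p²`, by isoperimetry, because the mismatch over a whole sphere is zero
(`abs_crossingSum_le_sq`); and order `ε n² + ε n p`, because near constancy makes the mismatch
average out on squares of side about `ε n` (`abs_crossingSum_le_patches`).

Now widen the annulus symmetrically about a middle radius and let `G` be the boundary length swept
so far, so that `p` is its increment. The bound by `p²` makes `√G` grow linearly, so `G` has order
at least `J²` after `J` steps. The bound by `n²` caps `G` after `2J` steps, so some later step has
`p` of order at most `n² / J`. There the third bound gives `J² ≲ ε n² + ε n³ / J`, which fails when
`J` is a fixed fraction of `n` and `ε` is small (`growth_bound`, `tileable_of_thick_annulus`). -/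

namespace Dimer

open scoped Classical

noncomputable section

/-! ### Lattice directions and parity -/

/-- The six lattice directions: a coordinate axis together with an orientation. -/
abbrev Dir : Type := Fin 3 × ℤˣ

/-- The unit step in a lattice direction. -/
def step (d : Dir) : Vertex := Pi.single d.1 (d.2 : ℤ)

/-- The opposite direction. -/
def opp (d : Dir) : Dir := (d.1, -d.2)

@[simp] theorem opp_opp (d : Dir) : opp (opp d) = d := by simp [opp]

@[simp] theorem step_opp (d : Dir) : step (opp d) = -step d := by
  simp [step, opp, Pi.single_neg]

theorem add_step_add_step_opp (x : Vertex) (d : Dir) : x + step d + step (opp d) = x := by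
  simp

theorem step_injective : Function.Injective step := by
  rintro ⟨i, σ⟩ ⟨j, ρ⟩ h
  have hi := congrFun h i
  simp only [step, Pi.single_eq_same] at hi
  by_cases hij : i = j
  · subst hij
    simp only [Pi.single_eq_same] at hi
    rw [Units.ext hi]
  · rw [Pi.single_eq_of_ne hij] at hi
    exact absurd hi σ.ne_zero

theorem cubicLattice_adj_iff {x y : Vertex} :
    cubicLattice.Adj x y ↔ ∃ d, y = x + step d := by
  constructor
  · intro h
    have h' : |x 0 - y 0| + |x 1 - y 1| + |x 2 - y 2| = 1 := by
      have : ∑ i, |x i - y i| = 1 := h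
      rwa [Fin.sum_univ_three] at this
    have hcase : ∃ (i : Fin 3) (σ : ℤˣ), y i = x i + σ ∧ ∀ j, j ≠ i → y j = x j := by
      have h0 := abs_nonneg (x 0 - y 0)
      have h1 := abs_nonneg (x 1 - y 1)
      have h2 := abs_nonneg (x 2 - y 2)
      have key : ∀ a b : ℤ, |a - b| = 1 → ∃ σ : ℤˣ, b = a + σ := by
        intro a b hab
        rcases (abs_eq zero_le_one).1 hab with h | h
        · exact ⟨-1, by simp; omega⟩
        · exact ⟨1, by simp; omega⟩
      have key0 : ∀ a b : ℤ, |a - b| = 0 → b = a := by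
        intro a b hab
        rw [abs_eq_zero] at hab; omega
      rcases (by omega : (|x 0 - y 0| = 1 ∧ |x 1 - y 1| = 0 ∧ |x 2 - y 2| = 0) ∨
        (|x 0 - y 0| = 0 ∧ |x 1 - y 1| = 1 ∧ |x 2 - y 2| = 0) ∨
        (|x 0 - y 0| = 0 ∧ |x 1 - y 1| = 0 ∧ |x 2 - y 2| = 1)) with h | h | h
      · obtain ⟨σ, hσ⟩ := key _ _ h.1
        refine ⟨0, σ, hσ, fun j hj => ?_⟩
        fin_cases j
        · exact absurd rfl hj
        · exact key0 _ _ h.2.1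
        · exact key0 _ _ h.2.2
      · obtain ⟨σ, hσ⟩ := key _ _ h.2.1
        refine ⟨1, σ, hσ, fun j hj => ?_⟩
        fin_cases j
        · exact key0 _ _ h.1
        · exact absurd rfl hj
        · exact key0 _ _ h.2.2
      · obtain ⟨σ, hσ⟩ := key _ _ h.2.2
        refine ⟨2, σ, hσ, fun j hj => ?_⟩
        fin_cases j
        · exact key0 _ _ h.1
        · exact key0 _ _ h.2.1
        · exact absurd rfl hj
    obtain ⟨i, σ, hi, hj⟩ := hcase
    refine ⟨(i, σ), funext fun j => ?_⟩
    by_cases hji : j = i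
    · subst hji; simp [step, hi]
    · simp [step, hj j hji, Pi.single_eq_of_ne hji]
  · rintro ⟨⟨i, σ⟩, rfl⟩
    change ∑ j, |x j - (x + step (i, σ)) j| = 1
    rw [Finset.sum_eq_single i]
    · rcases Int.units_eq_one_or σ with rfl | rfl <;> simp [step]
    · intro j _ hj
      simp [step, Pi.single_eq_of_ne hj]
    · simp

/-- The sign `+1` of an even lattice point and `-1` of an odd one. -/
def sgn (x : Vertex) : ℝ := if IsEven x then 1 else -1

theorem isEven_add_step (x : Vertex) (d : Dir) : IsEven (x + step d) ↔ ¬ IsEven x := by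
  have : ∑ i, (x + step d) i = ∑ i, x i + (d.2 : ℤ) := by
    simp [Finset.sum_add_distrib, step]
  unfold IsEven
  rw [this]
  rcases Int.units_eq_one_or d.2 with h | h <;> rw [h] <;> simp [Int.even_add]

theorem sgn_add_step (x : Vertex) (d : Dir) : sgn (x + step d) = -sgn x := by
  unfold sgn
  rw [isEven_add_step]
  by_cases h : IsEven x <;> simp [h]

theorem sgn_eq_or (x : Vertex) : sgn x = 1 ∨ sgn x = -1 := by
  unfold sgn; split_ifs <;> simp

theorem abs_sgn (x : Vertex) : |sgn x| = 1 := by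
  rcases sgn_eq_or x with h | h <;> simp [h]

/-! ### Fractional matchings -/

/-- A fractional perfect matching of `ℤ³`: nonnegative edge weights with sum one at every
vertex. -/
structure FractionalMatching where
  /-- The weight of the edge leaving a vertex in a given direction. -/
  weight : Vertex → Dir → ℝ
  nonneg : ∀ x d, 0 ≤ weight x d
  symm : ∀ x d, weight (x + step d) (opp d) = weight x d
  sum_eq_one : ∀ x, ∑ d, weight x d = 1

theorem FractionalMatching.le_one (f : FractionalMatching) (x : Vertex) (d : Dir) :
    f.weight x d ≤ 1 := by
  rw [← f.sum_eq_one x]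
  exact Finset.single_le_sum (fun d _ => f.nonneg x d) (Finset.mem_univ d)

/-- A dimer tiling as a fractional matching. -/
def DimerTiling.toFractional (τ : DimerTiling) : FractionalMatching where
  weight x d := if τ.1.Adj x (x + step d) then 1 else 0
  nonneg x d := by split_ifs <;> norm_num
  symm x d := by
    rw [add_step_add_step_opp, SimpleGraph.Subgraph.adj_comm]
  sum_eq_one x := by
    obtain ⟨y, hy, huniq⟩ := SimpleGraph.Subgraph.isPerfectMatching_iff.1 τ.2 x
    obtain ⟨d, rfl⟩ := cubicLattice_adj_iff.1 hy.adj_sub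
    rw [Finset.sum_eq_single d]
    · simp [hy]
    · intro e _ he
      rw [if_neg]
      intro h
      exact he (step_injective (add_left_cancel (huniq _ h)))
    · simp

/-- The translation invariant fractional matching with mean current `s`. -/
def uniformMatching (s : Fin 3 → ℝ) (hs : ∑ i, |s i| ≤ 1) : FractionalMatching where
  -- The odd term carries the current, `|s d.1| / 2` is just enough to keep it nonnegative, and the
  -- unused mass is spread equally over the six directions.
  weight x d := |s d.1| / 2 + (1 - ∑ i, |s i|) / 6 + sgn x * ((d.2 : ℤ) : ℝ) * s d.1 / 2
  nonneg x d := by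
    have : |sgn x * ((d.2 : ℤ) : ℝ) * s d.1| = |s d.1| := by
      rw [abs_mul, abs_mul, abs_sgn]
      rcases Int.units_eq_one_or d.2 with h | h <;> simp [h]
    have := neg_abs_le (sgn x * ((d.2 : ℤ) : ℝ) * s d.1)
    linarith
  symm x d := by
    rw [sgn_add_step]
    simp [opp]
  sum_eq_one x := by
    rw [Fintype.sum_prod_type]
    have : ∀ i : Fin 3, ∑ σ : ℤˣ, (|s i| / 2 + (1 - ∑ i, |s i|) / 6 +
        sgn x * ((σ : ℤ) : ℝ) * s i / 2) = |s i| + (1 - ∑ i, |s i|) / 3 := by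
      intro i
      rw [UnitsInt.univ]
      rw [Finset.sum_pair (by decide)]
      simp
      ring
    simp only [this, Finset.sum_add_distrib]
    simp
    ring

/-- For interior `s` this lower bound is positive: it is the price charged to each edge leaving `V`
from a point of `N` in the middle of the annulus. -/
theorem le_uniformMatching_weight (s : Fin 3 → ℝ) (hs : ∑ i, |s i| ≤ 1) (x : Vertex) (d : Dir) :
    (1 - ∑ i, |s i|) / 6 ≤ (uniformMatching s hs).weight x d := by
  have : |sgn x * ((d.2 : ℤ) : ℝ) * s d.1| = |s d.1| := by
    rw [abs_mul, abs_mul, abs_sgn]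
    rcases Int.units_eq_one_or d.2 with h | h <;> simp [h]
  have := neg_abs_le (sgn x * ((d.2 : ℤ) : ℝ) * s d.1)
  change _ ≤ |s d.1| / 2 + (1 - ∑ i, |s i|) / 6 + sgn x * ((d.2 : ℤ) : ℝ) * s d.1 / 2
  linarith

/-! ### Divergence theorem, sup-norm balls and their faces -/

/-- Discrete divergence theorem: the contributions of the edges inside `A` cancel. -/
theorem sum_sgn_mul_eq_boundary (h : Vertex → Dir → ℝ)
    (hsymm : ∀ x d, h (x + step d) (opp d) = h x d) (A : Finset Vertex) :
    ∑ x ∈ A, ∑ d, sgn x * h x d =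
      ∑ x ∈ A, ∑ d, if x + step d ∈ A then 0 else sgn x * h x d := by
  rw [← sub_eq_zero, ← Finset.sum_sub_distrib]
  simp only [← Finset.sum_sub_distrib]
  rw [← Finset.sum_product']
  -- Reversing an edge inside `A` keeps `h` and flips `sgn`; edges leaving `A` already have
  -- difference zero.
  refine Finset.sum_involution (fun p hp => if p.1 + step p.2 ∈ A then
    (p.1 + step p.2, opp p.2) else p) ?_ ?_ ?_ ?_
  · rintro ⟨x, d⟩ hp
    have hx : x ∈ A := (Finset.mem_product.1 hp).1
    by_cases hA : x + step d ∈ A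
    · simp [hA, hx, ← hsymm x d, sgn_add_step]
    · simp [hA]
  · rintro ⟨x, d⟩ hp hne
    by_cases hA : x + step d ∈ A
    · simp only [hA, if_true]
      intro heq
      have := congrArg (fun p => sgn p.1) heq
      simp only [sgn_add_step] at this
      rcases sgn_eq_or x with h | h <;> rw [h] at this <;> norm_num at this
    · simp [hA] at hne
  · rintro ⟨x, d⟩ hp
    by_cases hA : x + step d ∈ A
    · simp [hA]
    · simpa [hA] using hp
  · rintro ⟨x, d⟩ hp
    have hx : x ∈ A := (Finset.mem_product.1 hp).1
    by_cases hA : x + step d ∈ A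
    · simp [hA, hx]
    · simp [hA]

/-- The sup-norm of a lattice point. -/
def rad (x : Vertex) : ℕ := Finset.univ.sup fun i => (x i).natAbs

theorem rad_le_iff {x : Vertex} {k : ℕ} : rad x ≤ k ↔ ∀ i, |x i| ≤ k := by
  simp only [rad, Finset.sup_le_iff, Finset.mem_univ, true_imp_iff]
  exact forall_congr' fun i => by rw [Int.abs_eq_natAbs]; norm_cast

theorem abs_le_rad (x : Vertex) (i : Fin 3) : |x i| ≤ rad x := rad_le_iff.1 le_rfl i

theorem rad_add_step_le (x : Vertex) (d : Dir) : rad (x + step d) ≤ rad x + 1 := by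
  rw [rad_le_iff]
  intro i
  have h1 := abs_le_rad x i
  have h2 : |step d i| ≤ 1 := by
    by_cases h : i = d.1
    · subst h
      rcases Int.units_eq_one_or d.2 with h | h <;> simp [step, h]
    · simp [step, Pi.single_eq_of_ne h]
  calc |(x + step d) i| ≤ |x i| + |step d i| := abs_add_le _ _
    _ ≤ _ := by push_cast; omega

theorem rad_le_add_step (x : Vertex) (d : Dir) : rad x ≤ rad (x + step d) + 1 := by
  simpa using rad_add_step_le (x + step d) (opp d)

/-- The lattice ball of radius `k` in the sup-norm. -/
def ball (k : ℕ) : Finset Vertex := Fintype.piFinset fun _ => Finset.Icc (-(k : ℤ)) k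

@[simp] theorem mem_ball {k : ℕ} {x : Vertex} : x ∈ ball k ↔ rad x ≤ k := by
  simp [ball, rad_le_iff, abs_le]

theorem lt_rad_add_step_iff {k : ℕ} {x : Vertex} {d : Dir} (hx : rad x ≤ k) :
    k < rad (x + step d) ↔ x d.1 = d.2 * k := by
  rw [rad_le_iff] at hx
  rw [← not_le, rad_le_iff]
  constructor
  · intro h
    by_contra hne
    refine h fun i => ?_
    by_cases hi : i = d.1
    · subst hi
      have := abs_le.1 (hx d.1)
      rw [abs_le]
      rcases Int.units_eq_one_or d.2 with h | h <;> simp [step, h] at hne ⊢ <;> omega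
    · simpa [step, Pi.single_eq_of_ne hi] using hx i
  · intro h hall
    have := hall d.1
    rw [Pi.add_apply, h] at this
    rcases Int.units_eq_one_or d.2 with h | h <;> simp [step, h, abs_le] at this

/-- The lattice point with `i`-th coordinate `z` and the next two coordinates, in cyclic order,
`a` and `b`. -/
def facePoint (i : Fin 3) (z a b : ℤ) : Vertex :=
  fun m => if m = i then z else if m = i + 1 then a else b

@[simp] theorem facePoint_self (i : Fin 3) (z a b : ℤ) : facePoint i z a b i = z := by
  simp [facePoint]

@[simp] theorem facePoint_add_one (i : Fin 3) (z a b : ℤ) : facePoint i z a b (i + 1) = a := by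
  fin_cases i <;> simp [facePoint]

@[simp] theorem facePoint_add_two (i : Fin 3) (z a b : ℤ) : facePoint i z a b (i + 2) = b := by
  fin_cases i <;> simp [facePoint]

theorem forall_fin_three_cyclic {p : Fin 3 → Prop} (i : Fin 3) :
    (∀ j, p j) ↔ p i ∧ p (i + 1) ∧ p (i + 2) := by
  fin_cases i <;> simp [Fin.forall_fin_succ] <;> tauto

theorem facePoint_eta (i : Fin 3) (x : Vertex) :
    facePoint i (x i) (x (i + 1)) (x (i + 2)) = x := by
  refine funext ((forall_fin_three_cyclic i).2 ⟨?_, ?_, ?_⟩) <;> simp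

theorem facePoint_add_step_self (i : Fin 3) (σ : ℤˣ) (z a b : ℤ) :
    facePoint i z a b + step (i, σ) = facePoint i (z + σ) a b := by
  refine funext ((forall_fin_three_cyclic i).2 ⟨?_, ?_, ?_⟩) <;> simp [step]

theorem facePoint_add_step_one (i : Fin 3) (σ : ℤˣ) (z a b : ℤ) :
    facePoint i z a b + step (i + 1, σ) = facePoint i z (a + σ) b := by
  refine funext ((forall_fin_three_cyclic i).2 ⟨?_, ?_, ?_⟩) <;> fin_cases i <;>
    simp [step, facePoint]

theorem facePoint_add_step_two (i : Fin 3) (σ : ℤˣ) (z a b : ℤ) :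
    facePoint i z a b + step (i + 2, σ) = facePoint i z a (b + σ) := by
  refine funext ((forall_fin_three_cyclic i).2 ⟨?_, ?_, ?_⟩) <;> fin_cases i <;>
    simp [step, facePoint]

theorem rad_facePoint (i : Fin 3) (σ : ℤˣ) {k : ℕ} {a b : ℤ} (ha : |a| ≤ k) (hb : |b| ≤ k) :
    rad (facePoint i (σ * k) a b) = k := by
  have hz : |(σ : ℤ) * k| = k := by
    rcases Int.units_eq_one_or σ with h | h <;> simp [h]
  refine le_antisymm (rad_le_iff.2 ((forall_fin_three_cyclic i).2 ?_)) ?_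
  · simp [hz, ha, hb]
  · have := abs_le_rad (facePoint i (σ * k) a b) i
    rw [facePoint_self, hz] at this
    exact_mod_cast this

/-- The sum of `F` over the oriented edges leaving the ball of radius `k`, written as a sum over
the six faces. -/
theorem sum_crossing_eq_sum_faces (k : ℕ) (F : Vertex → Dir → ℝ) :
    (∑ x ∈ ball k, ∑ d, if k < rad (x + step d) then F x d else 0) =
      ∑ d : Dir, ∑ a ∈ Finset.Icc (-(k : ℤ)) k, ∑ b ∈ Finset.Icc (-(k : ℤ)) k,
        F (facePoint d.1 (d.2 * k) a b) d := by
  rw [Finset.sum_comm]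
  refine Finset.sum_congr rfl fun d _ => ?_
  rw [← Finset.sum_filter, ← Finset.sum_product']
  refine Finset.sum_bij' (fun x _ => (x (d.1 + 1), x (d.1 + 2)))
    (fun p _ => facePoint d.1 (d.2 * k) p.1 p.2) ?_ ?_ ?_ ?_ ?_
  · intro x hx
    have hx := rad_le_iff.1 (mem_ball.1 (Finset.mem_filter.1 hx).1)
    simp only [Finset.mem_product, Finset.mem_Icc]
    exact ⟨abs_le.1 (hx _), abs_le.1 (hx _)⟩
  · rintro ⟨a, b⟩ hp
    simp only [Finset.mem_product, Finset.mem_Icc] at hp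
    have := rad_facePoint d.1 d.2 (abs_le.2 hp.1) (abs_le.2 hp.2)
    refine Finset.mem_filter.2 ⟨mem_ball.2 this.le, ?_⟩
    rw [lt_rad_add_step_iff this.le, facePoint_self]
  · intro x hx
    obtain ⟨hx, hlt⟩ := Finset.mem_filter.1 hx
    rw [lt_rad_add_step_iff (mem_ball.1 hx)] at hlt
    simp only
    rw [← hlt, facePoint_eta]
  · rintro ⟨a, b⟩ hp
    simp
  · intro x hx
    obtain ⟨hx, hlt⟩ := Finset.mem_filter.1 hx
    rw [lt_rad_add_step_iff (mem_ball.1 hx)] at hlt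
    simp only
    rw [← hlt, facePoint_eta]

/-- The sum of `F` over the oriented edges leaving the ball of radius `k` whose other endpoint
lies in `V`, written from the outside. -/
theorem sum_crossing_inward (V : Finset Vertex) (k : ℕ) (F : Vertex → Dir → ℝ) :
    (∑ x ∈ V, ∑ d, if k < rad x ∧ rad (x + step d) ≤ k then F x d else 0) =
      ∑ x ∈ ball k, ∑ d, if k < rad (x + step d) then
        (if x + step d ∈ V then F (x + step d) (opp d) else 0) else 0 := by
  rw [← Finset.sum_product', ← Finset.sum_product']
  simp only [← ite_and]
  rw [← Finset.sum_filter, ← Finset.sum_filter]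
  refine Finset.sum_bij' (fun p _ => (p.1 + step p.2, opp p.2))
    (fun p _ => (p.1 + step p.2, opp p.2)) ?_ ?_ ?_ ?_ ?_
  · rintro ⟨x, d⟩ hp
    simp at hp
    simp [hp]
  · rintro ⟨x, d⟩ hp
    simp at hp
    simp [hp]
  · rintro ⟨x, d⟩ hp
    simp
  · rintro ⟨x, d⟩ hp
    simp
  · rintro ⟨x, d⟩ hp
    simp

/-! ### Boundary of a set in a shell and the isoperimetric bound -/

/-- The tangential boundary of `V` in the shell of radius `κ`: the lattice edges inside the shell,
given by an endpoint and a positive coordinate direction, with exactly one endpoint in `V`. -/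
def shellBoundary (V : Finset Vertex) (κ : ℕ) : Finset (Vertex × Fin 3) :=
  {p ∈ ball κ ×ˢ Finset.univ | rad p.1 = κ ∧ rad (p.1 + step (p.2, 1)) = κ ∧
    ¬ (p.1 ∈ V ↔ p.1 + step (p.2, 1) ∈ V)}

theorem mem_shellBoundary {V : Finset Vertex} {κ : ℕ} {p : Vertex × Fin 3} :
    p ∈ shellBoundary V κ ↔ rad p.1 = κ ∧ rad (p.1 + step (p.2, 1)) = κ ∧
      ¬ (p.1 ∈ V ↔ p.1 + step (p.2, 1) ∈ V) := by
  simp only [shellBoundary, Finset.mem_filter, Finset.mem_product, Finset.mem_univ, mem_ball,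
    and_true, and_iff_right_iff_imp]
  exact fun h => h.1.le

/-- A function on an integer interval that does not change at any step is constant. -/
theorem const_of_step_const {p : ℤ → Prop} {a b : ℤ}
    (h : ∀ t, a ≤ t → t + 1 ≤ b → (p t ↔ p (t + 1))) {t u : ℤ} (hat : a ≤ t) (htb : t ≤ b)
    (hau : a ≤ u) (hub : u ≤ b) : p t ↔ p u := by
  have key : ∀ t, a ≤ t → t ≤ b → (p a ↔ p t) := by
    intro t hat
    induction t, hat using Int.leInduction with
    | base => exact fun _ => Iff.rfl
    | succ t hat ih =>
      intro htb
      exact (ih (by omega)).trans (h t hat htb)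
  exact (key t hat htb).symm.trans (key u hau hub)

/-- The sum of the values of `g` at those edges leaving the ball of radius `k` that are read off
as points of `V` in the shell of radius `κ`. -/
def crossingSum (V : Finset Vertex) (k κ : ℕ) (g : Dir → ℤ → ℤ → ℝ) : ℝ :=
  ∑ d : Dir, ∑ a ∈ Finset.Icc (-(k : ℤ)) k, ∑ b ∈ Finset.Icc (-(k : ℤ)) k,
    if facePoint d.1 (d.2 * κ) a b ∈ V then g d a b else 0

theorem card_Icc_neg (k : ℕ) : (Finset.Icc (-(k : ℤ)) k).card = 2 * k + 1 := by
  simp; omega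

theorem card_dir : (Finset.univ : Finset Dir).card = 6 := by
  simp

theorem abs_crossingSum_le_card (V : Finset Vertex) (k κ : ℕ) (g : Dir → ℤ → ℤ → ℝ)
    (hg : ∀ d a b, |g d a b| ≤ 1) : |crossingSum V k κ g| ≤ 6 * (2 * k + 1) ^ 2 := by
  unfold crossingSum
  calc _ ≤ ∑ d : Dir, ∑ a ∈ Finset.Icc (-(k : ℤ)) k, ∑ b ∈ Finset.Icc (-(k : ℤ)) k, (1 : ℝ) := by
        refine (Finset.abs_sum_le_sum_abs _ _).trans (Finset.sum_le_sum fun d _ => ?_)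
        refine (Finset.abs_sum_le_sum_abs _ _).trans (Finset.sum_le_sum fun a _ => ?_)
        refine (Finset.abs_sum_le_sum_abs _ _).trans (Finset.sum_le_sum fun b _ => ?_)
        split_ifs
        · exact hg d a b
        · simp
    _ = _ := by
        simp only [Finset.sum_const, card_Icc_neg, card_dir, nsmul_eq_mul]
        push_cast
        ring

theorem facePoint_mem_shellBoundary_one {V : Finset Vertex} {κ : ℕ} {i : Fin 3} {σ : ℤˣ} {a b : ℤ}
    (ha : -(κ : ℤ) ≤ a) (ha' : a + 1 ≤ κ) (hb : |b| ≤ κ)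
    (h : ¬ (facePoint i (σ * κ) a b ∈ V ↔ facePoint i (σ * κ) (a + 1) b ∈ V)) :
    (facePoint i (σ * κ) a b, i + 1) ∈ shellBoundary V κ := by
  have e : facePoint i (σ * κ) a b + step (i + 1, 1) = facePoint i (σ * κ) (a + 1) b := by
    rw [facePoint_add_step_one]; simp
  rw [mem_shellBoundary]
  simp only [e]
  refine ⟨rad_facePoint i σ (abs_le.2 ⟨?_, ?_⟩) hb, rad_facePoint i σ (abs_le.2 ⟨?_, ?_⟩) hb, h⟩ <;>
    omega

theorem facePoint_mem_shellBoundary_two {V : Finset Vertex} {κ : ℕ} {i : Fin 3} {σ : ℤˣ} {a b : ℤ}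
    (ha : |a| ≤ κ) (hb : -(κ : ℤ) ≤ b) (hb' : b + 1 ≤ κ)
    (h : ¬ (facePoint i (σ * κ) a b ∈ V ↔ facePoint i (σ * κ) a (b + 1) ∈ V)) :
    (facePoint i (σ * κ) a b, i + 2) ∈ shellBoundary V κ := by
  have e : facePoint i (σ * κ) a b + step (i + 2, 1) = facePoint i (σ * κ) a (b + 1) := by
    rw [facePoint_add_step_two]; simp
  rw [mem_shellBoundary]
  simp only [e]
  refine ⟨rad_facePoint i σ ha (abs_le.2 ⟨?_, ?_⟩), rad_facePoint i σ ha (abs_le.2 ⟨?_, ?_⟩), h⟩ <;>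
    omega

/-- The `i`-th coordinates of the tangential boundary edges of `V` in a shell. -/
def boundaryCoords (V : Finset Vertex) (κ : ℕ) (i : Fin 3) : Finset ℤ :=
  (shellBoundary V κ).image fun p => p.1 i

/-- Along the line only the `i + 2` coordinate varies, so a change of membership would be a boundary
edge whose `i + 1` coordinate is still `a`. -/
theorem facePoint_mem_iff_of_notMem_one {V : Finset Vertex} {κ : ℕ} {i : Fin 3} {σ : ℤˣ}
    {a b b' : ℤ} (ha : |a| ≤ κ) (hb : |b| ≤ κ) (hb' : |b'| ≤ κ)
    (h : a ∉ boundaryCoords V κ (i + 1)) :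
    facePoint i (σ * κ) a b ∈ V ↔ facePoint i (σ * κ) a b' ∈ V := by
  rw [abs_le] at hb hb'
  refine const_of_step_const (p := fun b => facePoint i (σ * κ) a b ∈ V) (fun t ht ht' => ?_)
    hb.1 hb.2 hb'.1 hb'.2
  by_contra hne
  exact h (Finset.mem_image.2 ⟨_, facePoint_mem_shellBoundary_two ha ht ht' hne, by simp⟩)

theorem facePoint_mem_iff_of_notMem_two {V : Finset Vertex} {κ : ℕ} {i : Fin 3} {σ : ℤˣ}
    {a a' b : ℤ} (ha : |a| ≤ κ) (ha' : |a'| ≤ κ) (hb : |b| ≤ κ)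
    (h : b ∉ boundaryCoords V κ (i + 2)) :
    facePoint i (σ * κ) a b ∈ V ↔ facePoint i (σ * κ) a' b ∈ V := by
  rw [abs_le] at ha ha'
  refine const_of_step_const (p := fun a => facePoint i (σ * κ) a b ∈ V) (fun t ht ht' => ?_)
    ha.1 ha.2 ha'.1 ha'.2
  by_contra hne
  exact h (Finset.mem_image.2 ⟨_, facePoint_mem_shellBoundary_one ht ht' hb hne, by simp⟩)

theorem facePoint_rotate (i : Fin 3) (z a b : ℤ) :
    facePoint i z a b = facePoint (i + 1) a b z := by
  funext m
  fin_cases i <;> fin_cases m <;> simp [facePoint]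

theorem fin_three_add (i : Fin 3) : i + 1 + 2 = i ∧ i + 2 + 1 = i ∧ i + 1 + 1 = i + 2 := by
  revert i
  decide

/-- If no boundary edge of `V` meets the ring of points of the shell with `i`-th coordinate `t`,
then the ring lies inside `V` or is disjoint from it. -/
theorem ring_constant {V : Finset Vertex} {κ : ℕ} {i : Fin 3} {t : ℤ} (ht : |t| ≤ κ)
    (h : t ∉ boundaryCoords V κ i) (σ : ℤˣ) {u : ℤ} (hu : |u| ≤ κ) :
    (facePoint (i + 1) (σ * κ) u t ∈ V ↔ facePoint i t κ κ ∈ V) ∧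
      (facePoint (i + 2) (σ * κ) t u ∈ V ↔ facePoint i t κ κ ∈ V) := by
  have e1 : i + 1 + 2 = i := (fin_three_add i).1
  have e2 : i + 2 + 1 = i := (fin_three_add i).2.1
  have e3 : i + 1 + 1 = i + 2 := (fin_three_add i).2.2
  have hκ : |(κ : ℤ)| ≤ κ := by simp
  have hκ' : |-(κ : ℤ)| ≤ κ := by simp
  have s1 : ∀ (ρ : ℤˣ) {u u' : ℤ}, |u| ≤ κ → |u'| ≤ κ →
      (facePoint (i + 1) (ρ * κ) u t ∈ V ↔ facePoint (i + 1) (ρ * κ) u' t ∈ V) :=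
    fun ρ _ _ hu hu' => facePoint_mem_iff_of_notMem_two hu hu' ht (by rwa [e1])
  have s2 : ∀ (ρ : ℤˣ) {u u' : ℤ}, |u| ≤ κ → |u'| ≤ κ →
      (facePoint (i + 2) (ρ * κ) t u ∈ V ↔ facePoint (i + 2) (ρ * κ) t u' ∈ V) :=
    fun ρ _ _ hu hu' => facePoint_mem_iff_of_notMem_one ht hu hu' (by rwa [e2])
  have r1 : ∀ z u : ℤ, facePoint (i + 1) z u t = facePoint i t z u := by
    intro z u; rw [facePoint_rotate i]
  have r2 : ∀ z u : ℤ, facePoint (i + 2) z t u = facePoint i t u z := by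
    intro z u; rw [facePoint_rotate i, facePoint_rotate (i + 1), e3]
  -- The ring has four straight sides, each constant by `s1` or `s2`; `c1`, ..., `c4` glue them at
  -- the corners.
  have c1 : facePoint (i + 1) (((1 : ℤˣ) : ℤ) * κ) κ t = facePoint i t κ κ := by rw [r1]; simp
  have c2 : facePoint (i + 2) (((1 : ℤˣ) : ℤ) * κ) t κ = facePoint i t κ κ := by rw [r2]; simp
  have c3 : facePoint (i + 1) (((-1 : ℤˣ) : ℤ) * κ) κ t =
      facePoint (i + 2) (((1 : ℤˣ) : ℤ) * κ) t (-κ) := by rw [r1, r2]; simp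
  have c4 : facePoint (i + 2) (((-1 : ℤˣ) : ℤ) * κ) t κ =
      facePoint (i + 1) (((1 : ℤˣ) : ℤ) * κ) (-κ) t := by rw [r1, r2]; simp
  rcases Int.units_eq_one_or σ with rfl | rfl
  · exact ⟨by rw [s1 1 hu hκ, c1], by rw [s2 1 hu hκ, c2]⟩
  · exact ⟨by rw [s1 (-1) hu hκ, c3, s2 1 hκ' hκ, c2], by rw [s2 (-1) hu hκ, c4, s1 1 hκ' hκ, c1]⟩

/-- If the shell has an unbroken ring in each coordinate direction, then membership in `V` has one
common value off the crossings of broken rings. -/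
theorem exists_typical_value {V : Finset Vertex} {κ : ℕ}
    (hgood : ∀ i, ∃ t : ℤ, |t| ≤ κ ∧ t ∉ boundaryCoords V κ i) :
    ∃ v : Prop, ∀ (i : Fin 3) (σ : ℤˣ) (a b : ℤ), |a| ≤ κ → |b| ≤ κ →
      (a ∉ boundaryCoords V κ (i + 1) ∨ b ∉ boundaryCoords V κ (i + 2)) →
      (facePoint i (σ * κ) a b ∈ V ↔ v) := by
  choose T hT hTb using hgood
  -- Rings in different coordinate directions cross, so two unbroken ones share a point and hence
  -- their value.
  have link : ∀ (i : Fin 3) (t t' : ℤ), |t| ≤ κ → |t'| ≤ κ → t ∉ boundaryCoords V κ i →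
      t' ∉ boundaryCoords V κ (i + 1) →
      (facePoint i t κ κ ∈ V ↔ facePoint (i + 1) t' κ κ ∈ V) := by
    intro i t t' ht ht' h h'
    have e3 : i + 1 + 1 = i + 2 := (fin_three_add i).2.2
    have h1 := (ring_constant ht h 1 ht').2
    have h2 := (ring_constant ht' h' 1 ht).1
    rw [e3] at h2
    exact h1.symm.trans h2
  have hv : ∀ i : Fin 3, facePoint i (T i) κ κ ∈ V ↔ facePoint 0 (T 0) κ κ ∈ V := by
    have h01 := link 0 (T 0) (T 1) (hT 0) (hT 1) (hTb 0) (hTb 1)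
    have h12 := link 1 (T 1) (T 2) (hT 1) (hT 2) (hTb 1) (hTb 2)
    intro i
    fin_cases i
    · exact Iff.rfl
    · exact h01.symm
    · exact h12.symm.trans h01.symm
  have hall : ∀ (i : Fin 3) (t : ℤ), |t| ≤ κ → t ∉ boundaryCoords V κ i →
      (facePoint i t κ κ ∈ V ↔ facePoint 0 (T 0) κ κ ∈ V) := fun i t ht h =>
    (link i t (T (i + 1)) ht (hT _) h (hTb _)).trans (hv _)
  refine ⟨facePoint 0 (T 0) κ κ ∈ V, fun i σ a b ha hb h => ?_⟩
  rcases h with h | h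
  · have e : i + 1 + 2 = i := (fin_three_add i).1
    have := (ring_constant ha h σ hb).2
    rw [e] at this
    exact this.trans (hall _ _ ha h)
  · have e : i + 2 + 1 = i := (fin_three_add i).2.1
    have := (ring_constant hb h σ ha).1
    rw [e] at this
    exact this.trans (hall _ _ hb h)

/-- Isoperimetric bound: if `g` has total sum zero, then its sum over `V` is bounded by the square
of the length of the boundary of `V` in the shell. -/
theorem abs_crossingSum_le_sq (V : Finset Vertex) {k κ : ℕ} (hk : k ≤ κ) (g : Dir → ℤ → ℤ → ℝ)
    (hg : ∀ d a b, |g d a b| ≤ 1)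
    (h0 : ∑ d : Dir, ∑ a ∈ Finset.Icc (-(k : ℤ)) k, ∑ b ∈ Finset.Icc (-(k : ℤ)) k, g d a b = 0) :
    |crossingSum V k κ g| ≤ 6 * ((shellBoundary V κ).card : ℝ) ^ 2 := by
  have hcard : ∀ i, (boundaryCoords V κ i).card ≤ (shellBoundary V κ).card :=
    fun i => Finset.card_image_le
  by_cases hgood : ∀ i, ∃ t : ℤ, |t| ≤ κ ∧ t ∉ boundaryCoords V κ i
  · obtain ⟨v, hv⟩ := exists_typical_value hgood
    -- As `g` has total zero, the typical value can be subtracted for free. Only crossings of two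
    -- broken rings remain, at most the square of the perimeter on each face.
    have e : crossingSum V k κ g = ∑ d : Dir, ∑ a ∈ Finset.Icc (-(k : ℤ)) k,
        ∑ b ∈ Finset.Icc (-(k : ℤ)) k, ((if facePoint d.1 (d.2 * κ) a b ∈ V then g d a b else 0) -
          (if v then 1 else 0) * g d a b) := by
      simp only [Finset.sum_sub_distrib, ← Finset.mul_sum, h0]
      rw [mul_zero, sub_zero]
      rfl
    rw [e]
    have hface : ∀ d : Dir, ∑ a ∈ Finset.Icc (-(k : ℤ)) k, ∑ b ∈ Finset.Icc (-(k : ℤ)) k,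
        (if a ∈ boundaryCoords V κ (d.1 + 1) then (1 : ℝ) else 0) *
          (if b ∈ boundaryCoords V κ (d.1 + 2) then 1 else 0) ≤
        ((shellBoundary V κ).card : ℝ) ^ 2 := by
      intro d
      have hle : ∀ i, ∑ a ∈ Finset.Icc (-(k : ℤ)) k, (if a ∈ boundaryCoords V κ i then (1 : ℝ)
          else 0) ≤ (shellBoundary V κ).card := by
        intro i
        rw [Finset.sum_boole]
        have : (Finset.filter (· ∈ boundaryCoords V κ i) (Finset.Icc (-(k : ℤ)) k)).card ≤
            (boundaryCoords V κ i).card :=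
          Finset.card_le_card fun a ha => (Finset.mem_filter.1 ha).2
        exact_mod_cast this.trans (hcard i)
      rw [← Finset.sum_mul_sum, sq]
      refine mul_le_mul (hle _) (hle _) (Finset.sum_nonneg fun _ _ => ?_) (by positivity)
      split_ifs <;> norm_num
    calc _ ≤ ∑ d : Dir, ((shellBoundary V κ).card : ℝ) ^ 2 := by
          refine (Finset.abs_sum_le_sum_abs _ _).trans (Finset.sum_le_sum fun d _ => ?_)
          refine le_trans ?_ (hface d)
          refine (Finset.abs_sum_le_sum_abs _ _).trans (Finset.sum_le_sum fun a ha => ?_)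
          refine (Finset.abs_sum_le_sum_abs _ _).trans (Finset.sum_le_sum fun b hb => ?_)
          have ha' : |a| ≤ κ := (abs_le.2 (Finset.mem_Icc.1 ha)).trans (by exact_mod_cast hk)
          have hb' : |b| ≤ κ := (abs_le.2 (Finset.mem_Icc.1 hb)).trans (by exact_mod_cast hk)
          have hgd := hg d a b
          by_cases h1 : a ∈ boundaryCoords V κ (d.1 + 1)
          · by_cases h2 : b ∈ boundaryCoords V κ (d.1 + 2)
            · simp only [h1, h2, if_true]
              split_ifs <;> simp [hgd]
            · simp [h2, hv d.1 d.2 a b ha' hb' (Or.inr h2)]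
          · simp [h1, hv d.1 d.2 a b ha' hb' (Or.inl h1)]
      _ = _ := by simp
  -- Every ring in direction `i` is broken, so the perimeter is at least `2k + 1` and the trivial
  -- bound suffices.
  · push Not at hgood
    obtain ⟨i, hi⟩ := hgood
    refine (abs_crossingSum_le_card V k κ g hg).trans ?_
    have : 2 * k + 1 ≤ (shellBoundary V κ).card := by
      refine le_trans ?_ (hcard i)
      rw [← card_Icc_neg]
      refine Finset.card_le_card fun t ht => hi t ?_
      exact (abs_le.2 (Finset.mem_Icc.1 ht)).trans (by exact_mod_cast hk)
    have h' : (2 * (k : ℝ) + 1) ≤ (shellBoundary V κ).card := by exact_mod_cast this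
    gcongr

/-! ### Cutting the faces into patches -/

/-- The rows of the grid `I × J` on which the predicate `W` is not constant. -/
def brokenRows (I J : Finset ℤ) (W : ℤ → ℤ → Prop) : Finset ℤ :=
  {a ∈ I | ∃ b ∈ J, ∃ b' ∈ J, ¬ (W a b ↔ W a b')}

/-- If some row is unbroken, take its value: a point that disagrees with it lies in a broken column.
If all rows are broken, the first term already counts the whole grid. -/
theorem exists_typical_value_grid (I J : Finset ℤ) (W : ℤ → ℤ → Prop) :
    ∃ v : Prop, ((I ×ˢ J).filter fun p => ¬ (W p.1 p.2 ↔ v)).card ≤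
      (brokenRows I J W).card * J.card + I.card * (brokenRows J I fun b a => W a b).card := by
  by_cases hrow : ∃ a ∈ I, a ∉ brokenRows I J W
  · obtain ⟨a, ha, hbad⟩ := hrow
    have hconst : ∀ b ∈ J, ∀ b' ∈ J, (W a b ↔ W a b') := by
      intro b hb b' hb'
      by_contra hne
      exact hbad (Finset.mem_filter.2 ⟨ha, b, hb, b', hb', hne⟩)
    rcases J.eq_empty_or_nonempty with rfl | ⟨b₀, hb₀⟩
    · exact ⟨True, by simp⟩
    refine ⟨W a b₀, le_trans ?_ (Nat.le_add_left _ _)⟩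
    rw [← Finset.card_product]
    refine Finset.card_le_card fun p hp => ?_
    obtain ⟨hp, hne⟩ := Finset.mem_filter.1 hp
    obtain ⟨h1, h2⟩ := Finset.mem_product.1 hp
    refine Finset.mem_product.2 ⟨h1, Finset.mem_filter.2 ⟨h2, p.1, h1, a, ha, fun h => hne ?_⟩⟩
    exact h.trans (hconst _ h2 _ hb₀)
  · push Not at hrow
    suffices h : ∀ v : Prop, ((I ×ˢ J).filter fun p => ¬ (W p.1 p.2 ↔ v)).card ≤ _ from
      ⟨True, h True⟩
    refine fun v => le_trans ?_ (Nat.le_add_right _ _)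
    have : I ⊆ brokenRows I J W := hrow
    calc _ ≤ (I ×ˢ J).card := Finset.card_filter_le _ _
      _ = I.card * J.card := Finset.card_product _ _
      _ ≤ _ := Nat.mul_le_mul_right _ (Finset.card_le_card this)

theorem abs_sum_grid_le (I J : Finset ℤ) (W : ℤ → ℤ → Prop) [∀ a b, Decidable (W a b)]
    (g : ℤ → ℤ → ℝ)     (hg : ∀ a b, |g a b| ≤ 1) :
    |∑ a ∈ I, ∑ b ∈ J, if W a b then g a b else 0| ≤ |∑ a ∈ I, ∑ b ∈ J, g a b| +
      ((brokenRows I J W).card * J.card + I.card * (brokenRows J I fun b a => W a b).card) := by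
  obtain ⟨v, hv⟩ := exists_typical_value_grid I J W
  have hv' : (((I ×ˢ J).filter fun p => ¬ (W p.1 p.2 ↔ v)).card : ℝ) ≤
      (brokenRows I J W).card * J.card + I.card * (brokenRows J I fun b a => W a b).card := by
    have h : (((I ×ˢ J).filter fun p => ¬ (W p.1 p.2 ↔ v)).card) ≤
        (brokenRows I J W).card * J.card +
          I.card * (brokenRows J I fun b a => W a b).card := by
      convert hv
    exact_mod_cast h
  have e : ∑ a ∈ I, ∑ b ∈ J, (if W a b then g a b else 0) =
      (if v then 1 else 0) * ∑ a ∈ I, ∑ b ∈ J, g a b +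
        ∑ p ∈ I ×ˢ J, ((if W p.1 p.2 then g p.1 p.2 else 0) -
          (if v then 1 else 0) * g p.1 p.2) := by
    rw [Finset.sum_sub_distrib, ← Finset.mul_sum, ← Finset.sum_product', ← Finset.sum_product']
    ring
  rw [e]
  refine (abs_add_le _ _).trans (add_le_add ?_ (le_trans ?_ hv'))
  · split_ifs <;> simp
  · rw [← Finset.sum_boole]
    refine (Finset.abs_sum_le_sum_abs _ _).trans (Finset.sum_le_sum fun p _ => ?_)
    have := hg p.1 p.2
    by_cases h1 : W p.1 p.2 <;> by_cases h2 : v <;> simp [h1, h2, this]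

theorem sum_Ico_eq_sum_blocks {q : ℕ} (hq : 0 < q) (B : ℕ) (f : ℤ → ℝ) :
    ∑ a ∈ Finset.Ico (-(B * q : ℤ)) (B * q), f a =
      ∑ β ∈ Finset.Ico (-(B : ℤ)) B, ∑ a ∈ Finset.Ico (β * q) (β * q + q), f a := by
  have hq' : (0 : ℤ) < q := by exact_mod_cast hq
  rw [← Finset.sum_fiberwise_of_maps_to (t := Finset.Ico (-(B : ℤ)) B) (g := fun a => a / (q : ℤ))]
  · refine Finset.sum_congr rfl fun β hβ => Finset.sum_congr ?_ fun _ _ => rfl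
    ext a
    rw [Finset.mem_Ico] at hβ
    simp only [Finset.mem_filter, Finset.mem_Ico]
    constructor
    · rintro ⟨-, rfl⟩
      have h1 := Int.ediv_mul_le a hq'.ne'
      have h2 := Int.lt_ediv_add_one_mul_self a hq'
      constructor <;> linarith
    · rintro ⟨h1, h2⟩
      refine ⟨⟨by nlinarith, by nlinarith⟩, ?_⟩
      refine le_antisymm (Int.lt_add_one_iff.1 ((Int.ediv_lt_iff_lt_mul hq').2 (by linarith))) ?_
      exact (Int.le_ediv_iff_mul_le hq').2 h1
  · intro a ha
    rw [Finset.mem_Ico] at ha ⊢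
    exact ⟨(Int.le_ediv_iff_mul_le hq').2 (by linarith), (Int.ediv_lt_iff_lt_mul hq').2 ha.2⟩

theorem exists_step_change {p : ℤ → Prop} {m M b b' : ℤ} (hb : b ∈ Finset.Ico m M)
    (hb' : b' ∈ Finset.Ico m M) (h : ¬ (p b ↔ p b')) :
    ∃ t, m ≤ t ∧ t + 1 < M ∧ ¬ (p t ↔ p (t + 1)) := by
  rw [Finset.mem_Ico] at hb hb'
  by_contra! hcon
  exact h (const_of_step_const (a := m) (b := M - 1) (fun t h1 h2 => hcon t h1 (by omega))
    hb.1 (by omega) hb'.1 (by omega))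

/-- If every broken row of a block comes from a point of a finite set `P`, then the total number of
broken rows in all blocks is at most the cardinality of `P`. -/
theorem sum_card_brokenRows_le {ι : Type*} (P : Finset ι) (x y : ι → ℤ) {q : ℕ} (hq : 0 < q)
    (B : ℕ) (W : ℤ → ℤ → Prop)
    (hW : ∀ a b : ℤ, a ∈ Finset.Ico (-(B * q : ℤ)) (B * q) →
      b ∈ Finset.Ico (-(B * q : ℤ)) (B * q) → b + 1 ∈ Finset.Ico (-(B * q : ℤ)) (B * q) →
      ¬ (W a b ↔ W a (b + 1)) → ∃ i ∈ P, x i = a ∧ y i = b) :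
    ∑ β ∈ Finset.Ico (-(B : ℤ)) B, ∑ γ ∈ Finset.Ico (-(B : ℤ)) B,
      ((brokenRows (Finset.Ico (β * q) (β * q + q)) (Finset.Ico (γ * q) (γ * q + q)) W).card : ℝ) ≤
      P.card := by
  have hq' : (0 : ℤ) < q := by exact_mod_cast hq
  rw [Finset.sum_comm]
  calc _ = ∑ γ ∈ Finset.Ico (-(B : ℤ)) B, ∑ a ∈ Finset.Ico (-(B * q : ℤ)) (B * q),
        if ∃ b ∈ Finset.Ico (γ * q) (γ * q + q), ∃ b' ∈ Finset.Ico (γ * q) (γ * q + q),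
          ¬ (W a b ↔ W a b') then (1 : ℝ) else 0 := by
        refine Finset.sum_congr rfl fun γ _ => ?_
        rw [sum_Ico_eq_sum_blocks hq]
        refine Finset.sum_congr rfl fun β _ => ?_
        rw [Finset.sum_boole]
        rfl
    _ = ((Finset.Ico (-(B : ℤ)) B ×ˢ Finset.Ico (-(B * q : ℤ)) (B * q)).filter fun r : ℤ × ℤ =>
        ∃ b ∈ Finset.Ico (r.1 * q) (r.1 * q + q), ∃ b' ∈ Finset.Ico (r.1 * q) (r.1 * q + q),
          ¬ (W r.2 b ↔ W r.2 b')).card := by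
        rw [← Finset.sum_product', Finset.sum_boole]
    -- A broken row of a block contains a change, hence a point of `P` that determines both the row
    -- and the block column.
    _ ≤ (P.image fun i => (y i / (q : ℤ), x i)).card := by
        refine Nat.cast_le.2 (Finset.card_le_card ?_)
        rintro ⟨γ, a⟩ hr
        obtain ⟨hr, b, hb, b', hb', hne⟩ := Finset.mem_filter.1 hr
        obtain ⟨hγ, ha⟩ := Finset.mem_product.1 hr
        simp only at hγ ha hb hb' hne
        obtain ⟨t, ht, ht', hne⟩ := exists_step_change hb hb' hne
        rw [Finset.mem_Ico] at hγ
        obtain ⟨i, hi, rfl, rfl⟩ := hW a t ha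
          (Finset.mem_Ico.2 ⟨by nlinarith, by nlinarith⟩)
          (Finset.mem_Ico.2 ⟨by nlinarith, by nlinarith⟩) hne
        refine Finset.mem_image.2 ⟨i, hi, Prod.ext ?_ rfl⟩
        refine le_antisymm
          (Int.lt_add_one_iff.1 ((Int.ediv_lt_iff_lt_mul hq').2 (by linarith))) ?_
        exact (Int.le_ediv_iff_mul_le hq').2 ht
    _ ≤ P.card := Nat.cast_le.2 Finset.card_image_le

theorem abs_sum_le_card {ι : Type*} (s : Finset ι) (F : ι → ℝ) (hF : ∀ i, |F i| ≤ 1) :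
    |∑ i ∈ s, F i| ≤ s.card := by
  refine (Finset.abs_sum_le_sum_abs _ _).trans ?_
  simpa using Finset.sum_le_card_nsmul s (fun i => |F i|) 1 fun i _ => hF i

/-- If `g` has small average on every patch of side `q`, then its sum over `V` is bounded in terms
of the length of the boundary of `V` in the shell. -/
theorem abs_crossingSum_le_patches (V : Finset Vertex) {k κ q : ℕ} (hk : k ≤ κ) (hq : 0 < q)
    {θ : ℝ} (hθ : 0 ≤ θ) (g : Dir → ℤ → ℤ → ℝ) (hg : ∀ d a b, |g d a b| ≤ 1)
    (hpatch : ∀ (d : Dir) (a b : ℤ), -(k : ℤ) < a → a + q ≤ k → -(k : ℤ) < b → b + q ≤ k →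
      |∑ a' ∈ Finset.Ico a (a + q), ∑ b' ∈ Finset.Ico b (b + q), g d a' b'| ≤ θ * q ^ 2) :
    |crossingSum V k κ g| ≤ 6 * (θ * (2 * k + 1) ^ 2 + 2 * q * (shellBoundary V κ).card +
      2 * (2 * k + 1) * (2 * q + 1)) := by
  have hq' : (0 : ℤ) < q := by exact_mod_cast hq
  -- For `k > 0`, `B` is the largest number with `B * q < k`. The inequality is strict because
  -- `hpatch` excludes the coordinate `-k`.
  obtain ⟨B, hB1, hB2⟩ : ∃ B : ℕ, (B = 0 ∨ B * q < k) ∧ k ≤ B * q + q := by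
    refine ⟨(k - 1) / q, ?_, ?_⟩
    · rcases Nat.eq_zero_or_pos k with rfl | hkpos
      · left; simp
      · right
        have := Nat.div_mul_le_self (k - 1) q
        omega
    · have := Nat.lt_div_mul_add (a := k - 1) hq
      omega
  have hBk : B * q ≤ k := by
    rcases hB1 with rfl | h
    · simp
    · exact h.le
  have hBk' : (B * q : ℤ) ≤ k := by exact_mod_cast hBk
  set S := Finset.Ico (-(B * q : ℤ)) (B * q) with hS
  set I := Finset.Icc (-(k : ℤ)) k with hI
  have hSI : S ×ˢ S ⊆ I ×ˢ I := by
    have : S ⊆ I := fun a ha => by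
      rw [hS, Finset.mem_Ico] at ha
      rw [hI, Finset.mem_Icc]
      constructor <;> linarith
    exact Finset.product_subset_product this this
  have hSmem : ∀ a ∈ S, |a| ≤ κ ∧ -(κ : ℤ) ≤ a := fun a ha => by
    rw [hS, Finset.mem_Ico] at ha
    have : (k : ℤ) ≤ κ := by exact_mod_cast hk
    rw [abs_le]
    omega
  have hScard : S.card = 2 * (B * q) := by
    rw [hS, Int.card_Ico]
    norm_cast
    omega
  suffices hface : ∀ d : Dir, |∑ a ∈ I, ∑ b ∈ I,
      if facePoint d.1 (d.2 * κ) a b ∈ V then g d a b else 0| ≤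
      θ * (2 * k + 1) ^ 2 + 2 * q * (shellBoundary V κ).card + 2 * (2 * k + 1) * (2 * q + 1) by
    refine (Finset.abs_sum_le_sum_abs _ _).trans ((Finset.sum_le_sum fun d _ => hface d).trans ?_)
    rw [Finset.sum_const, card_dir, nsmul_eq_mul]
    push_cast
    exact le_rfl
  rintro ⟨i, σ⟩
  simp only
  set W : ℤ → ℤ → Prop := fun a b => facePoint i (σ * κ) a b ∈ V with hW
  change |∑ a ∈ I, ∑ b ∈ I, if W a b then g (i, σ) a b else 0| ≤ _
  -- The face is split into the blocked square `S ×ˢ S` and the frame around it, which is too narrow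
  -- to hold blocks and is bounded by its area.
  rw [← Finset.sum_product', ← Finset.sum_sdiff hSI, Finset.sum_product, add_comm]
  refine (abs_add_le _ _).trans (add_le_add ?_ ?_)
  · have e : ∑ a ∈ S, ∑ b ∈ S, (if W a b then g (i, σ) a b else 0) =
        ∑ β ∈ Finset.Ico (-(B : ℤ)) B, ∑ γ ∈ Finset.Ico (-(B : ℤ)) B,
          ∑ a ∈ Finset.Ico (β * q) (β * q + q), ∑ b ∈ Finset.Ico (γ * q) (γ * q + q),
            if W a b then g (i, σ) a b else 0 := by
      rw [hS, sum_Ico_eq_sum_blocks hq]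
      refine Finset.sum_congr rfl fun β _ => ?_
      rw [Finset.sum_comm (s := Finset.Ico (-(B : ℤ)) B)]
      exact Finset.sum_congr rfl fun a _ => sum_Ico_eq_sum_blocks hq B _
    rw [e]
    have hrows := sum_card_brokenRows_le (shellBoundary V κ) (fun p => p.1 (i + 1))
      (fun p => p.1 (i + 2)) hq B W (by
        intro a b ha hb hb' hne
        refine ⟨_, facePoint_mem_shellBoundary_two (hSmem a ha).1 (hSmem b hb).2
          (le_of_abs_le (hSmem _ hb').1) hne, by simp⟩)
    have hcols := sum_card_brokenRows_le (shellBoundary V κ) (fun p => p.1 (i + 2))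
      (fun p => p.1 (i + 1)) hq B (fun b a => W a b) (by
        intro b a hb ha ha' hne
        refine ⟨_, facePoint_mem_shellBoundary_one (hSmem a ha).2
          (le_of_abs_le (hSmem _ ha').1) (hSmem b hb).1 hne, by simp⟩)
    rw [Finset.sum_comm] at hcols
    have hcardIco : ∀ m : ℤ, (Finset.Ico m (m + q)).card = q := fun m => by simp
    calc _ ≤ ∑ β ∈ Finset.Ico (-(B : ℤ)) B, ∑ γ ∈ Finset.Ico (-(B : ℤ)) B,
          (θ * q ^ 2 + ((brokenRows (Finset.Ico (β * q) (β * q + q))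
            (Finset.Ico (γ * q) (γ * q + q)) W).card * q +
            q * (brokenRows (Finset.Ico (γ * q) (γ * q + q)) (Finset.Ico (β * q) (β * q + q))
              fun b a => W a b).card)) := by
          refine (Finset.abs_sum_le_sum_abs _ _).trans (Finset.sum_le_sum fun β hβ => ?_)
          refine (Finset.abs_sum_le_sum_abs _ _).trans (Finset.sum_le_sum fun γ hγ => ?_)
          refine (abs_sum_grid_le _ _ W (g (i, σ)) fun a b => hg _ a b).trans ?_
          rw [hcardIco, hcardIco]
          refine add_le_add_left ?_ _
          rw [Finset.mem_Ico] at hβ hγ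
          have hBpos : (B * q : ℤ) < k := by
            rcases hB1 with h | h
            · subst h; simp at hβ; omega
            · exact_mod_cast h
          refine hpatch (i, σ) _ _ ?_ ?_ ?_ ?_ <;> nlinarith
      _ ≤ θ * (2 * (B * q)) ^ 2 + ((shellBoundary V κ).card * q +
          q * (shellBoundary V κ).card) := by
          simp only [Finset.sum_add_distrib, ← Finset.sum_mul, ← Finset.mul_sum]
          refine add_le_add (le_of_eq ?_) (add_le_add ?_ ?_)
          · simp only [Finset.sum_const, Int.card_Ico, nsmul_eq_mul]
            have : ((B : ℤ) - -(B : ℤ)).toNat = 2 * B := by omega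
            rw [this]
            push_cast
            ring
          · exact mul_le_mul_of_nonneg_right hrows (by positivity)
          · exact mul_le_mul_of_nonneg_left hcols (by positivity)
      _ ≤ _ := by
          have h1 : ((B : ℝ) * q) ≤ k := by exact_mod_cast hBk
          have h2 : (2 * ((B : ℝ) * q)) ^ 2 ≤ (2 * k + 1) ^ 2 := by
            gcongr
            linarith
          have := mul_le_mul_of_nonneg_left h2 hθ
          linarith
  · calc _ ≤ (((I ×ˢ I) \ (S ×ˢ S)).card : ℝ) := by
          refine abs_sum_le_card _ _ fun p => ?_
          by_cases hp : W p.1 p.2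
          · rw [if_pos hp]
            exact hg _ _ _
          · rw [if_neg hp, abs_zero]
            exact zero_le_one
      _ = (2 * k + 1) ^ 2 - (2 * (B * q)) ^ 2 := by
          rw [Finset.cast_card_sdiff hSI, Finset.card_product, Finset.card_product, hScard, hI,
            card_Icc_neg]
          push_cast
          ring
      -- Difference of squares: the factors are at most `2q + 1` and `2(2k + 1)`.
      _ ≤ _ := by
          have h1 : ((B : ℝ) * q) ≤ k := by exact_mod_cast hBk
          have h2 : (k : ℝ) ≤ B * q + q := by exact_mod_cast hB2
          have h3 : (0 : ℝ) ≤ B * q := by positivity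
          nlinarith

/-! ### Flux mismatch and the imbalance inequality -/

/-- The difference of the fluxes of two fractional matchings through the edge that leaves the ball
of radius `k` at a given position of a given face. -/
def fluxDifference (w f : FractionalMatching) (k : ℕ) (d : Dir) (a b : ℤ) : ℝ :=
  sgn (facePoint d.1 (d.2 * k) a b) *
    (w.weight (facePoint d.1 (d.2 * k) a b) d - f.weight (facePoint d.1 (d.2 * k) a b) d)

theorem abs_fluxDifference_le (w f : FractionalMatching) (k : ℕ) (d : Dir) (a b : ℤ) :
    |fluxDifference w f k d a b| ≤ 1 := by
  rw [fluxDifference, abs_mul, abs_sgn, one_mul, abs_le]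
  have h1 := w.nonneg (facePoint d.1 (d.2 * k) a b) d
  have h2 := f.nonneg (facePoint d.1 (d.2 * k) a b) d
  have h3 := w.le_one (facePoint d.1 (d.2 * k) a b) d
  have h4 := f.le_one (facePoint d.1 (d.2 * k) a b) d
  constructor <;> linarith

/-- All vertex sums are one, so the net flux out of a ball is its excess of even over odd points,
whatever the matching. This is why the total mismatch of two matchings vanishes. -/
theorem FractionalMatching.sum_crossing (f : FractionalMatching) (k : ℕ) :
    (∑ x ∈ ball k, ∑ d, if k < rad (x + step d) then sgn x * f.weight x d else 0) =
      ∑ x ∈ ball k, sgn x := by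
  have := sum_sgn_mul_eq_boundary f.weight f.symm (ball k)
  simp only [← Finset.mul_sum, f.sum_eq_one, mul_one] at this
  rw [this]
  refine Finset.sum_congr rfl fun x _ => Finset.sum_congr rfl fun d _ => ?_
  by_cases h : rad (x + step d) ≤ k
  · simp [h, not_lt.2 h]
  · simp [h, not_le.1 h]

theorem sum_fluxDifference (w f : FractionalMatching) (k : ℕ) :
    ∑ d : Dir, ∑ a ∈ Finset.Icc (-(k : ℤ)) k, ∑ b ∈ Finset.Icc (-(k : ℤ)) k,
      fluxDifference w f k d a b = 0 := by
  have hw := w.sum_crossing k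
  have hf := f.sum_crossing k
  rw [sum_crossing_eq_sum_faces k fun x d => sgn x * w.weight x d] at hw
  rw [sum_crossing_eq_sum_faces k fun x d => sgn x * f.weight x d] at hf
  simp only [fluxDifference, mul_sub, Finset.sum_sub_distrib]
  rw [hw, hf, sub_self]

theorem sum_crossing_out_eq (V : Finset Vertex) (w f : FractionalMatching) (k : ℕ) :
    (∑ x ∈ V, ∑ d, if rad x ≤ k ∧ k < rad (x + step d) then
      sgn x * (w.weight x d - f.weight x d) else 0) =
      crossingSum V k k (fluxDifference w f k) := by
  have h := sum_crossing_eq_sum_faces k fun x d =>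
    if x ∈ V then sgn x * (w.weight x d - f.weight x d) else 0
  refine Eq.trans ?_ h
  have e1 : ∀ x, (∑ d, if rad x ≤ k ∧ k < rad (x + step d) then
      sgn x * (w.weight x d - f.weight x d) else 0) = if rad x ≤ k then
        (∑ d, if k < rad (x + step d) then sgn x * (w.weight x d - f.weight x d) else 0)
          else 0 := by
    intro x
    by_cases hx : rad x ≤ k <;> simp [hx]
  have e2 : ∀ x, (∑ d, if k < rad (x + step d) then
      (if x ∈ V then sgn x * (w.weight x d - f.weight x d) else 0) else 0) = if x ∈ V then
        (∑ d, if k < rad (x + step d) then sgn x * (w.weight x d - f.weight x d) else 0)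
          else 0 := by
    intro x
    by_cases hx : x ∈ V <;> simp [hx]
  simp only [e1, e2]
  rw [← Finset.sum_filter, ← Finset.sum_filter]
  refine Finset.sum_congr ?_ fun _ _ => rfl
  ext x
  simp [and_comm]

/-- The edges are now seen from their outer endpoint, the one in the middle region: membership is
read in the shell `k + 1`, and the reversed parity gives the minus sign. -/
theorem sum_crossing_in_eq (V : Finset Vertex) (w f : FractionalMatching) (k : ℕ) :
    (∑ x ∈ V, ∑ d, if k < rad x ∧ rad (x + step d) ≤ k then
      sgn x * (w.weight x d - f.weight x d) else 0) =
      -crossingSum V k (k + 1) (fluxDifference w f k) := by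
  rw [sum_crossing_inward V k fun x d => sgn x * (w.weight x d - f.weight x d)]
  rw [sum_crossing_eq_sum_faces k fun x d => if x + step d ∈ V then
    sgn (x + step d) * (w.weight (x + step d) (opp d) - f.weight (x + step d) (opp d)) else 0]
  rw [crossingSum]
  simp only [← Finset.sum_neg_distrib]
  refine Finset.sum_congr rfl fun d _ => Finset.sum_congr rfl fun a _ =>
    Finset.sum_congr rfl fun b _ => ?_
  have e : facePoint d.1 (d.2 * k) a b + step d = facePoint d.1 (d.2 * (k + 1 : ℕ)) a b := by
    have := facePoint_add_step_self d.1 d.2 (d.2 * k) a b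
    rw [this]
    push_cast
    rw [mul_add, mul_one]
  rw [w.symm, f.symm, sgn_add_step, e, fluxDifference]
  split_ifs <;> simp

/-- The number of edges leaving `V` inside the annulus `kin < ‖x‖ ≤ kout` is at least the total
length of the boundaries of `V` in the shells of the annulus. -/
theorem sum_card_shellBoundary_le (V : Finset Vertex) (kin kout : ℕ) :
    ∑ κ ∈ Finset.Ioc kin kout, ((shellBoundary V κ).card : ℝ) ≤
      ∑ x ∈ V, ∑ d : Dir, if (kin < rad x ∧ rad x ≤ kout) ∧
        (kin < rad (x + step d) ∧ rad (x + step d) ≤ kout) ∧ x + step d ∉ V then 1 else 0 := by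
  rw [← Finset.sum_product', Finset.sum_boole, ← Nat.cast_sum, ← Finset.card_biUnion]
  · refine Nat.cast_le.2 (Finset.card_le_card_of_injOn
      (fun p => if p.1 ∈ V then (p.1, (p.2, 1)) else (p.1 + step (p.2, 1), (p.2, -1))) ?_ ?_)
    · rintro ⟨x, j⟩ hp
      obtain ⟨κ, hκ, hp⟩ := Finset.mem_biUnion.1 (Finset.mem_coe.1 hp)
      rw [mem_shellBoundary] at hp
      rw [Finset.mem_Ioc] at hκ
      simp only at hp
      obtain ⟨h1, h2, h3⟩ := hp
      by_cases hx : x ∈ V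
      · have hx' : x + step (j, 1) ∉ V := fun h => h3 ⟨fun _ => h, fun _ => hx⟩
        simp [hx, hx', h1, h2, hκ]
      · have hx' : x + step (j, 1) ∈ V := by
          by_contra h
          exact h3 ⟨fun h' => absurd h' hx, fun h' => absurd h' h⟩
        have e : x + step (j, 1) + step (j, -1) = x := add_step_add_step_opp x (j, 1)
        simp [hx, hx', h1, h2, hκ, e]
    · rintro ⟨x, j⟩ _ ⟨y, l⟩ _ h
      simp only at h
      split_ifs at h <;> simp only [Prod.mk.injEq] at h
      · rw [h.1, h.2.1]
      · exact absurd h.2.2 (by decide)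
      · exact absurd h.2.2 (by decide)
      · obtain ⟨h1, rfl, -⟩ := h
        rw [add_right_cancel h1]
  · intro κ _ κ' _ hne
    refine Finset.disjoint_left.2 fun p hp hp' => hne ?_
    rw [mem_shellBoundary] at hp hp'
    exact hp.1.symm.trans hp'.1

/-- Comparison of `V` with the hybrid of `f₁` outside the ball of radius `kout`, `w` in the annulus
and `f₂` inside the ball of radius `kin`. Here `V` is closed under following the edges of the
hybrid away from the points of sign `ς`. -/
theorem imbalance_le (V : Finset Vertex) {ς : ℝ} (hς : ς = 1 ∨ ς = -1)
    (w f₁ f₂ : FractionalMatching) {c : ℝ} (hc : 0 ≤ c) (hw : ∀ x d, c ≤ w.weight x d)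
    {kin kout : ℕ} (hk : kin < kout)
    (hmid : ∀ x ∈ V, ς * sgn x = 1 → ∀ d, kin < rad x → rad x ≤ kout →
      kin < rad (x + step d) → rad (x + step d) ≤ kout → x + step d ∈ V)
    (hout : ∀ x ∈ V, ς * sgn x = 1 → ∀ d, (kout < rad x ∨ kout < rad (x + step d)) →
      f₁.weight x d ≠ 0 → x + step d ∈ V)
    (hin : ∀ x ∈ V, ς * sgn x = 1 → ∀ d, (rad x ≤ kin ∨ rad (x + step d) ≤ kin) →
      f₂.weight x d ≠ 0 → x + step d ∈ V) :
    ς * ∑ x ∈ V, sgn x + c * ∑ κ ∈ Finset.Ioc kin kout, ((shellBoundary V κ).card : ℝ) ≤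
      |crossingSum V kout kout (fluxDifference w f₁ kout)| +
        |crossingSum V kin (kin + 1) (fluxDifference w f₂ kin)| := by
  -- The hybrid weighting. Its vertex sums differ from one only at the points of radius `kout` and
  -- `kin + 1`, where some edges of `w` are replaced by those of `f₁` or `f₂`.
  set h : Vertex → Dir → ℝ := fun x d =>
    if kout < rad x ∨ kout < rad (x + step d) then f₁.weight x d
    else if rad x ≤ kin ∨ rad (x + step d) ≤ kin then f₂.weight x d else w.weight x d with hh
  have hsymm : ∀ x d, h (x + step d) (opp d) = h x d := by
    intro x d
    simp only [hh, add_step_add_step_opp, f₁.symm, f₂.symm, w.symm, or_comm]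
  have hnonneg : ∀ x d, 0 ≤ h x d := by
    intro x d
    simp only [hh]
    split_ifs
    exacts [f₁.nonneg x d, f₂.nonneg x d, w.nonneg x d]
  have hsum : ∀ x, ∑ d, h x d = 1 -
      (∑ d, if rad x ≤ kout ∧ kout < rad (x + step d) then w.weight x d - f₁.weight x d else 0) -
      ∑ d, if kin < rad x ∧ rad (x + step d) ≤ kin then w.weight x d - f₂.weight x d else 0 := by
    intro x
    rcases lt_or_ge kout (rad x) with h1 | h1
    · have h2 : ∀ d, ¬ rad (x + step d) ≤ kin := fun d => by
        have := rad_le_add_step x d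
        omega
      simp [hh, h1, not_le.2 h1, h2, f₁.sum_eq_one]
    rcases le_or_gt (rad x) kin with h2 | h2
    · have h3 : ∀ d, ¬ kout < rad (x + step d) := fun d => by
        have := rad_add_step_le x d
        omega
      simp [hh, not_lt.2 h1, h2, not_lt.2 h2, h3, f₂.sum_eq_one]
    · rw [← w.sum_eq_one x, ← Finset.sum_sub_distrib, ← Finset.sum_sub_distrib]
      refine Finset.sum_congr rfl fun d _ => ?_
      by_cases h3 : kout < rad (x + step d)
      · have h4 : ¬ rad (x + step d) ≤ kin := by omega
        simp [hh, h1, h3, h4]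
      · by_cases h4 : rad (x + step d) ≤ kin <;>
          simp [hh, not_lt.2 h1, h2, not_le.2 h2, h3, h4]
  have hbdry : ς * ∑ x ∈ V, ∑ d, (if x + step d ∈ V then 0 else sgn x * h x d) ≤
      -(c * ∑ κ ∈ Finset.Ioc kin kout, ((shellBoundary V κ).card : ℝ)) := by
    refine le_trans ?_ (neg_le_neg (mul_le_mul_of_nonneg_left
      (sum_card_shellBoundary_le V kin kout) hc))
    rw [Finset.mul_sum, Finset.mul_sum, ← Finset.sum_neg_distrib]
    refine Finset.sum_le_sum fun x hx => ?_
    rw [Finset.mul_sum, Finset.mul_sum, ← Finset.sum_neg_distrib]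
    refine Finset.sum_le_sum fun d _ => ?_
    by_cases hxd : x + step d ∈ V
    · simp [hxd]
    rw [if_neg hxd]
    have hς' : ς * sgn x = 1 ∨ ς * sgn x = -1 := by
      rcases hς with h | h <;> rcases sgn_eq_or x with h' | h' <;> rw [h, h'] <;> simp
    have h1 := hnonneg x d
    rw [← mul_assoc]
    rcases hς' with hx1 | hx1
    -- At a point of sign `ς` the closure hypotheses leave no weight on edges out of `V`.
    · have h0 : h x d = 0 := by
        by_contra hne
        refine hxd ?_
        simp only [hh] at hne
        split_ifs at hne with h2 h3
        · exact hout x hx hx1 d h2 hne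
        · exact hin x hx hx1 d h3 hne
        · push Not at h2 h3
          exact hmid x hx hx1 d h3.1 h2.1 h3.2 h2.2
      have hnot : ¬ ((kin < rad x ∧ rad x ≤ kout) ∧
          (kin < rad (x + step d) ∧ rad (x + step d) ≤ kout) ∧ x + step d ∉ V) := fun hm =>
        hxd (hmid x hx hx1 d hm.1.1 hm.1.2 hm.2.1.1 hm.2.1.2)
      rw [h0, if_neg hnot]
      simp
    -- At a point of the other sign every outgoing edge counts negatively, by at least `c` where `h`
    -- is `w`.
    · rw [hx1]
      split_ifs with hm
      · have h2 : h x d = w.weight x d := by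
          have : ¬ (kout < rad x ∨ kout < rad (x + step d)) := by omega
          have h' : ¬ (rad x ≤ kin ∨ rad (x + step d) ≤ kin) := by omega
          simp [hh, this, h']
        have := hw x d
        linarith
      · linarith
  have htotal : ∑ x ∈ V, sgn x = (∑ x ∈ V, ∑ d, if x + step d ∈ V then 0 else sgn x * h x d) +
      crossingSum V kout kout (fluxDifference w f₁ kout) -
        crossingSum V kin (kin + 1) (fluxDifference w f₂ kin) := by
    rw [← sum_crossing_out_eq, sub_eq_add_neg, ← sum_crossing_in_eq,
      ← sum_sgn_mul_eq_boundary h hsymm, ← Finset.sum_add_distrib, ← Finset.sum_add_distrib]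
    refine Finset.sum_congr rfl fun x _ => ?_
    rw [← Finset.mul_sum, hsum]
    have e : ∀ (p : Dir → Prop) [DecidablePred p] (u : Dir → ℝ),
        (∑ d, if p d then sgn x * u d else 0) = sgn x * ∑ d, if p d then u d else 0 := by
      intro p _ u
      rw [Finset.mul_sum]
      exact Finset.sum_congr rfl fun d _ => by split_ifs <;> simp
    rw [e, e]
    ring
  have h1 := le_abs_self (ς * crossingSum V kout kout (fluxDifference w f₁ kout))
  have h2 := neg_abs_le (ς * crossingSum V kin (kin + 1) (fluxDifference w f₂ kin))
  have hςabs : |ς| = 1 := by rcases hς with h | h <;> simp [h]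
  rw [abs_mul, hςabs, one_mul] at h1 h2
  rw [htotal, mul_sub, mul_add]
  linarith

/-! ### Flux of a tiling through lattice patches -/

theorem unit_mul_self_real (σ : ℤˣ) : ((σ : ℤ) : ℝ) * ((σ : ℤ) : ℝ) = 1 := by
  rcases Int.units_eq_one_or σ with h | h <;> simp [h]

/-- The square of side `L` in the plane `xᵢ = σ (k + 1/2)` whose lowest corner has the tangential
coordinates `c₁` and `c₂`. -/
def faceSquare (d : Dir) (k : ℕ) (L c₁ c₂ : ℝ) : Set (Fin 3 → ℝ) :=
  {x | x d.1 = ((d.2 : ℤ) : ℝ) * ((k : ℝ) + 1 / 2) ∧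
    (c₁ ≤ x (d.1 + 1) ∧ x (d.1 + 1) ≤ c₁ + L) ∧ (c₂ ≤ x (d.1 + 2) ∧ x (d.1 + 2) ≤ c₂ + L)}

theorem isPatch_faceSquare {ε : ℝ} {k : ℕ} (d : Dir) {c₁ c₂ : ℝ}
    (h1 : -((k : ℝ) + 1 / 2) ≤ c₁) (h1' : c₁ + ε * k ≤ (k : ℝ) + 1 / 2)
    (h2 : -((k : ℝ) + 1 / 2) ≤ c₂) (h2' : c₂ + ε * k ≤ (k : ℝ) + 1 / 2) :
    IsPatch ε k (faceSquare d k (ε * k) c₁ c₂) (Pi.single d.1 ((d.2 : ℤ) : ℝ)) := by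
  have hne1 : d.1 + 1 ≠ d.1 := by simp
  have hne2 : d.1 + 2 ≠ d.1 := by simp
  have hne3 : d.1 + 2 ≠ d.1 + 1 := by simp
  refine ⟨d.1, (d.2 : ℤ), fun m => if m = d.1 + 1 then c₁ else c₂, ?_, rfl, ?_, ?_⟩
  · rcases Int.units_eq_one_or d.2 with h | h <;> simp [h]
  · intro j _
    dsimp only
    split_ifs
    exacts [⟨h1, h1'⟩, ⟨h2, h2'⟩]
  · ext x
    simp only [faceSquare, Set.mem_ofPred_eq]
    refine and_congr_right fun _ => ?_
    rw [forall_fin_three_cyclic d.1]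
    simp only [ne_eq, not_true_eq_false, false_imp_iff, true_and, hne1, hne2, hne3,
      not_false_eq_true, true_imp_iff, if_true, if_false]

/-- The edge through a given position of a face of the ball of radius `k`, oriented from even to
odd. -/
def faceEdge (d : Dir) (k : ℕ) (p : ℤ × ℤ) : Vertex × Vertex :=
  if IsEven (facePoint d.1 (d.2 * k) p.1 p.2) then
    (facePoint d.1 (d.2 * k) p.1 p.2, facePoint d.1 (d.2 * k) p.1 p.2 + step d)
  else (facePoint d.1 (d.2 * k) p.1 p.2 + step d, facePoint d.1 (d.2 * k) p.1 p.2)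

theorem step_ne {d : Dir} {m : Fin 3} (h : m ≠ d.1) : step d m = 0 := by
  simp [step, Pi.single_eq_of_ne h]

theorem step_self (d : Dir) : step d d.1 = d.2 := by simp [step]

theorem add_step_add_one (x : Vertex) (d : Dir) : (x + step d) (d.1 + 1) = x (d.1 + 1) := by
  rw [Pi.add_apply, step_ne (by simp), add_zero]

theorem add_step_add_two (x : Vertex) (d : Dir) : (x + step d) (d.1 + 2) = x (d.1 + 2) := by
  rw [Pi.add_apply, step_ne (by simp), add_zero]

theorem faceEdge_injective (d : Dir) (k : ℕ) : Function.Injective (faceEdge d k) := by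
  have key : ∀ p, ((faceEdge d k p).1 (d.1 + 1), (faceEdge d k p).1 (d.1 + 2)) = p := by
    intro p
    unfold faceEdge
    split_ifs
    · simp
    · simp only [add_step_add_one, add_step_add_two]
      simp
  intro p p' h
  rw [← key p, ← key p', h]

/-- The plane has a half-integer coordinate, so no edge parallel to it meets it, and a perpendicular
edge meeting it joins the layers `k` and `k + 1` of that face. -/
theorem mem_edgesMeeting_faceSquare_iff (d : Dir) (k : ℕ) (L c₁ c₂ : ℝ) (x y : Vertex) :
    (x, y) ∈ edgesMeeting (faceSquare d k L c₁ c₂) ↔ ∃ a b : ℤ,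
      (c₁ ≤ a ∧ a ≤ c₁ + L) ∧ (c₂ ≤ b ∧ b ≤ c₂ + L) ∧ faceEdge d k (a, b) = (x, y) := by
  obtain ⟨i, σ⟩ := d
  have hσ := unit_mul_self_real σ
  constructor
  · rintro ⟨heven, hadj, z, ⟨α, β, hα, hβ, hαβ, rfl⟩, hz⟩
    simp only at heven hadj hz
    obtain ⟨⟨j, ρ⟩, rfl⟩ := cubicLattice_adj_iff.1 hadj
    have hval : ∀ m, (α • toReal x + β • toReal (x + step (j, ρ))) m =
        (x m : ℝ) + β * (step (j, ρ) m : ℤ) := by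
      intro m
      have : α = 1 - β := by linarith
      subst this
      simp [toReal]
      ring
    obtain ⟨hz0, hz1, hz2⟩ := hz
    simp only [hval] at hz0 hz1 hz2
    have hji : j = i := by
      by_contra hne
      rw [step_ne (d := (j, ρ)) (Ne.symm hne)] at hz0
      have h2 : ((2 * x i : ℤ) : ℝ) = ((σ * (2 * k + 1) : ℤ) : ℝ) := by
        push_cast at hz0 ⊢
        linarith
      have h3 : 2 * x i = σ * (2 * k + 1) := by exact_mod_cast h2
      rcases Int.units_eq_one_or σ with h | h <;> rw [h] at h3 <;> simp at h3 <;> omega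
    subst hji
    rw [step_self (j, ρ)] at hz0
    rw [step_ne (d := (j, ρ)) (by simp)] at hz1 hz2
    simp only [Int.cast_zero, mul_zero, add_zero] at hz1 hz2
    refine ⟨x (j + 1), x (j + 2), hz1, hz2, ?_⟩
    have hβ1 : β ≤ 1 := by linarith
    have hz0' : ((σ * x j : ℤ) : ℝ) + β * ((σ : ℤ) * (ρ : ℤ)) = k + 1 / 2 := by
      have := congrArg (fun t => ((σ : ℤ) : ℝ) * t) hz0
      simp only at this
      push_cast
      calc _ = (σ : ℝ) * ((x j : ℝ) + β * (ρ : ℝ)) := by ring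
        _ = ((σ : ℝ) * σ) * (k + 1 / 2) := by rw [this]; ring
        _ = _ := by rw [hσ, one_mul]
    by_cases hρ : ρ = σ
    · subst hρ
      rw [hσ, mul_one] at hz0'
      have h1 : ((ρ * x j : ℤ) : ℝ) < ((k + 1 : ℤ) : ℝ) := by push_cast at hz0' ⊢; linarith
      have h2 : ((k - 1 : ℤ) : ℝ) < ((ρ * x j : ℤ) : ℝ) := by push_cast at hz0' ⊢; linarith
      have h1' : ρ * x j < k + 1 := by exact_mod_cast h1
      have h2' : (k - 1 : ℤ) < ρ * x j := by exact_mod_cast h2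
      have hxj : x j = ρ * k := by
        rcases Int.units_eq_one_or ρ with h | h <;> simp [h] at h1' h2' ⊢ <;> omega
      have hx : facePoint j (ρ * k) (x (j + 1)) (x (j + 2)) = x := by
        rw [← hxj, facePoint_eta]
      simp only [faceEdge, hx, heven, if_true]
    · have hρ' : ρ = -σ := by
        rcases Int.units_eq_one_or ρ with h | h <;> rcases Int.units_eq_one_or σ with h' | h' <;>
          simp [h, h'] at hρ ⊢
      subst hρ'
      have hσ' : ((σ : ℤ) : ℝ) * (((-σ : ℤˣ) : ℤ) : ℝ) = -1 := by
        push_cast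
        linarith
      rw [hσ'] at hz0'
      have h1 : ((σ * x j : ℤ) : ℝ) < ((k + 2 : ℤ) : ℝ) := by push_cast at hz0' ⊢; linarith
      have h2 : ((k : ℤ) : ℝ) < ((σ * x j : ℤ) : ℝ) := by push_cast at hz0' ⊢; linarith
      have h1' : σ * x j < k + 2 := by exact_mod_cast h1
      have h2' : (k : ℤ) < σ * x j := by exact_mod_cast h2
      have hxj : x j = σ * k + σ := by
        rcases Int.units_eq_one_or σ with h | h <;> simp [h] at h1' h2' ⊢ <;> omega
      have hx : facePoint j (σ * k) (x (j + 1)) (x (j + 2)) + step (j, σ) = x := by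
        rw [facePoint_add_step_self, ← hxj, facePoint_eta]
      have hp : facePoint j (σ * k) (x (j + 1)) (x (j + 2)) = x + step (j, -σ) := by
        conv_rhs => rw [← hx]
        exact (add_step_add_step_opp _ (j, σ)).symm
      have hodd : ¬ IsEven (x + step (j, -σ)) := by
        rw [isEven_add_step]
        exact not_not.2 heven
      have hx' : x + step (j, -σ) + step (j, σ) = x := by rw [← hp, hx]
      simp only [faceEdge, hp, hodd, if_false, hx']
  · rintro ⟨a, b, ha, hb, he⟩
    set p := facePoint i (σ * k) a b with hp
    have hmid : midpoint ℝ (toReal p) (toReal (p + step (i, σ))) ∈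
        faceSquare (i, σ) k L c₁ c₂ := by
      have hval : ∀ m, midpoint ℝ (toReal p) (toReal (p + step (i, σ))) m =
          (p m : ℝ) + 1 / 2 * (step (i, σ) m : ℤ) := by
        intro m
        rw [midpoint_eq_smul_add]
        simp [toReal]
        ring
      refine ⟨?_, ?_, ?_⟩ <;> rw [hval]
      · rw [step_self (i, σ)]
        simp [hp]
        ring
      · rw [step_ne (by simp)]
        simpa [hp] using ha
      · rw [step_ne (by simp)]
        simpa [hp] using hb
    have hadj : cubicLattice.Adj p (p + step (i, σ)) := cubicLattice_adj_iff.2 ⟨_, rfl⟩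
    rw [← he]
    unfold faceEdge
    simp only [← hp]
    split_ifs with heven
    · exact ⟨heven, hadj, _, midpoint_mem_segment _ _, hmid⟩
    · refine ⟨(isEven_add_step _ _).2 heven, hadj.symm, _, midpoint_mem_segment _ _, ?_⟩
      simp only
      rwa [midpoint_comm]

/-- The flux of a tiling through a square in a face, as a sum over the lattice positions of the
square. -/
theorem flux_faceSquare (τ : DimerTiling) (d : Dir) (k : ℕ) (L c₁ c₂ : ℝ) (A B : Finset ℤ)
    (hA : ∀ a : ℤ, a ∈ A ↔ c₁ ≤ a ∧ a ≤ c₁ + L) (hB : ∀ b : ℤ, b ∈ B ↔ c₂ ≤ b ∧ b ≤ c₂ + L) :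
    flux (pretilingFlow τ) (faceSquare d k L c₁ c₂) (Pi.single d.1 ((d.2 : ℤ) : ℝ)) =
      ∑ a ∈ A, ∑ b ∈ B, sgn (facePoint d.1 (d.2 * k) a b) *
        τ.toFractional.weight (facePoint d.1 (d.2 * k) a b) d := by
  have hset : edgesMeeting (faceSquare d k L c₁ c₂) = ↑((A ×ˢ B).image (faceEdge d k)) := by
    ext ⟨x, y⟩
    rw [mem_edgesMeeting_faceSquare_iff]
    simp only [Finset.coe_image, Set.mem_image, Finset.mem_coe, Finset.mem_product, Prod.exists,
      hA, hB, and_assoc]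
  rw [flux, hset, finsum_mem_coe_finset, Finset.sum_image (faceEdge_injective d k).injOn,
    Finset.sum_product]
  refine Finset.sum_congr rfl fun a _ => Finset.sum_congr rfl fun b _ => ?_
  set p := facePoint d.1 (d.2 * k) a b with hp
  have hdot : ∀ u : Fin 3 → ℝ, (Pi.single d.1 ((d.2 : ℤ) : ℝ) : Fin 3 → ℝ) ⬝ᵥ u =
      ((d.2 : ℤ) : ℝ) * u d.1 := fun u => by simp
  have hdiff : toReal (p + step d) d.1 - toReal p d.1 = ((d.2 : ℤ) : ℝ) := by
    simp [toReal, step_self]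
  unfold faceEdge
  simp only [← hp]
  split_ifs with heven
  · rw [hdot, Pi.sub_apply, hdiff, unit_mul_self_real]
    simp [pretilingFlow, heven, sgn, DimerTiling.toFractional]
  · have hdiff' : toReal p d.1 - toReal (p + step d) d.1 = -((d.2 : ℤ) : ℝ) := by
      rw [← hdiff]; ring
    rw [hdot, Pi.sub_apply, hdiff', mul_neg, unit_mul_self_real]
    have h' : IsEven (p + step d) := (isEven_add_step _ _).2 heven
    simp [pretilingFlow, heven, h', sgn, DimerTiling.toFractional, SimpleGraph.Subgraph.adj_comm]

theorem sum_alternating {f : ℤ → ℝ} (hf : ∀ t, f (t + 1) = -f t) (b : ℤ) (m : ℕ) :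
    ∑ t ∈ Finset.Ico b (b + (2 * m : ℕ)), f t = 0 := by
  induction m with
  | zero => simp
  | succ m ih =>
    have e : b + (2 * (m + 1) : ℕ) = b + (2 * m : ℕ) + 1 + 1 := by push_cast; ring
    have hsucc : ∀ t : ℤ, b ≤ t →
        ∑ u ∈ Finset.Ico b (t + 1), f u = ∑ u ∈ Finset.Ico b t, f u + f t := by
      intro t ht
      have : Finset.Ico b (t + 1) = insert t (Finset.Ico b t) := by
        ext u
        simp only [Finset.mem_insert, Finset.mem_Ico]
        omega
      rw [this, Finset.sum_insert (by simp), add_comm]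
    rw [e, hsucc _ (by omega), hsucc _ (by omega), ih, hf]
    simp

/-- Multiplying the weight by `sgn` leaves a constant plus a multiple of `sgn`. The latter
alternates and cancels because the side is even. -/
theorem sum_uniformMatching_patch (s : Fin 3 → ℝ) (hs : ∑ i, |s i| ≤ 1) (d : Dir) (k m : ℕ)
    (a b : ℤ) :
    ∑ a' ∈ Finset.Ico a (a + (2 * m : ℕ)), ∑ b' ∈ Finset.Ico b (b + (2 * m : ℕ)),
      sgn (facePoint d.1 (d.2 * k) a' b') *
        (uniformMatching s hs).weight (facePoint d.1 (d.2 * k) a' b') d =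
      1 / 2 * (((d.2 : ℤ) : ℝ) * s d.1) * ((2 * m : ℕ) : ℝ) ^ 2 := by
  have hw : ∀ x, sgn x * (uniformMatching s hs).weight x d =
      (|s d.1| / 2 + (1 - ∑ i, |s i|) / 6) * sgn x + 1 / 2 * (((d.2 : ℤ) : ℝ) * s d.1) := by
    intro x
    have : sgn x * sgn x = 1 := by rcases sgn_eq_or x with h | h <;> rw [h] <;> norm_num
    change sgn x * (|s d.1| / 2 + (1 - ∑ i, |s i|) / 6 + sgn x * ((d.2 : ℤ) : ℝ) * s d.1 / 2) = _
    linear_combination (((d.2 : ℤ) : ℝ) * s d.1 / 2) * this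
  have halt : ∀ a' : ℤ, ∑ b' ∈ Finset.Ico b (b + (2 * m : ℕ)),
      sgn (facePoint d.1 (d.2 * k) a' b') = 0 := by
    intro a'
    refine sum_alternating (f := fun t => sgn (facePoint d.1 (d.2 * k) a' t)) (fun t => ?_) b m
    rw [← sgn_add_step _ (d.1 + 2, 1), facePoint_add_step_two]
    simp
  simp only [hw, Finset.sum_add_distrib, ← Finset.mul_sum, halt]
  simp only [mul_zero, Finset.sum_const_zero, zero_add, Finset.sum_const, Int.card_Ico,
    add_sub_cancel_left, Int.toNat_natCast, nsmul_eq_mul]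
  ring

/-- The even number closest to the side length `ε k` of a patch. -/
def patchSide (ε : ℝ) (k : ℕ) : ℕ := 2 * ⌊(ε * k + 1) / 2⌋₊

theorem patchSide_le {ε : ℝ} (hε : 0 < ε) (k : ℕ) : (patchSide ε k : ℝ) ≤ ε * k + 1 := by
  have h : (⌊(ε * k + 1) / 2⌋₊ : ℝ) ≤ (ε * k + 1) / 2 := Nat.floor_le (by positivity)
  rw [patchSide]
  push_cast
  linarith

theorem lt_patchSide_add_one (ε : ℝ) (k : ℕ) : ε * k < patchSide ε k + 1 := by
  have h := Nat.lt_floor_add_one ((ε * k + 1) / 2)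
  rw [patchSide]
  push_cast
  linarith

/-- A nearly constant tiling has almost the same flux as the uniform matching through every
patch of a large ball. -/
theorem NearlyConstant.exists_patch_bound {ε : ℝ} (hε : 0 < ε) {s : Fin 3 → ℝ}
    (hs : ∑ i, |s i| ≤ 1) {τ : DimerTiling} (hτ : NearlyConstant ε s τ) {θ : ℝ} (hθ : 0 < θ) :
    ∃ K : ℕ, ∀ k : ℕ, K ≤ k → 0 < patchSide ε k ∧ ∀ (d : Dir) (a b : ℤ),
      -(k : ℤ) < a → a + patchSide ε k ≤ k → -(k : ℤ) < b → b + patchSide ε k ≤ k →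
      |∑ a' ∈ Finset.Ico a (a + patchSide ε k), ∑ b' ∈ Finset.Ico b (b + patchSide ε k),
        fluxDifference (uniformMatching s hs) τ.toFractional k d a' b'| ≤
        θ * (patchSide ε k : ℝ) ^ 2 := by
  -- As `L ≤ 2q`, the error `θ / 8 * L²` costs at most half of `θ * q²`; the other half absorbs the
  -- difference between `q²` and `L²`.
  obtain ⟨M, hM⟩ := hτ (θ / 8) (by positivity)
  obtain ⟨K, hK⟩ := exists_nat_ge ((6 / θ + 2) / ε)
  refine ⟨max K (M + 1), fun k hk => ?_⟩
  have hkK : (6 / θ + 2) / ε ≤ k := hK.trans (by exact_mod_cast (le_max_left _ _).trans hk)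
  have hkM : M < k := (le_max_right K (M + 1)).trans hk
  rw [div_le_iff₀ hε] at hkK
  have hq1 := patchSide_le hε k
  have hq2 := lt_patchSide_add_one ε k
  have hqeven : patchSide ε k = 2 * ⌊(ε * k + 1) / 2⌋₊ := rfl
  set q := patchSide ε k with hqdef
  have hθq : 6 / θ ≤ q := by linarith
  have h6 : 0 < 6 / θ := by positivity
  have hq1' : (1 : ℝ) ≤ q := by linarith
  refine ⟨by exact_mod_cast (by linarith : (0 : ℝ) < q), fun d a b ha ha' hb hb' => ?_⟩
  set L := ε * (k : ℝ) with hL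
  have hcast : ∀ t : ℤ, -(k : ℤ) < t → t + q ≤ k → (-(k : ℝ) + 1 ≤ t) ∧ (t : ℝ) + q ≤ k := by
    intro t h1 h2
    constructor
    · have : -(k : ℤ) + 1 ≤ t := h1
      exact_mod_cast this
    · exact_mod_cast h2
  obtain ⟨ha1, ha2⟩ := hcast a ha ha'
  obtain ⟨hb1, hb2⟩ := hcast b hb hb'
  -- Since `q - 1 ≤ L < q + 1`, an interval of length `L` centred on the `q` integers from `t` to `t
  -- + q - 1` contains exactly these.
  have hmem : ∀ t u : ℤ, u ∈ Finset.Ico t (t + q) ↔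
      (t : ℝ) - (L - q + 1) / 2 ≤ u ∧ u ≤ (t : ℝ) - (L - q + 1) / 2 + L := by
    intro t u
    rw [Finset.mem_Ico]
    constructor
    · rintro ⟨h1, h2⟩
      have h1' : (t : ℝ) ≤ u := by exact_mod_cast h1
      have h2' : (u : ℝ) + 1 ≤ t + q := by exact_mod_cast h2
      constructor <;> linarith
    · rintro ⟨h1, h2⟩
      have h1' : ((t - 1 : ℤ) : ℝ) < u := by push_cast; linarith
      have h2' : (u : ℝ) < ((t + q : ℤ) : ℝ) := by push_cast; linarith
      have h1'' : t - 1 < u := by exact_mod_cast h1'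
      exact ⟨by omega, by exact_mod_cast h2'⟩
  have hpatch := hM k hkM _ _ (isPatch_faceSquare (ε := ε) (k := k) d
    (c₁ := (a : ℝ) - (L - q + 1) / 2) (c₂ := (b : ℝ) - (L - q + 1) / 2)
    (by linarith) (by linarith) (by linarith) (by linarith))
  rw [flux_faceSquare τ d k _ _ _ _ _ (hmem a) (hmem b)] at hpatch
  have hdot : (Pi.single d.1 ((d.2 : ℤ) : ℝ) : Fin 3 → ℝ) ⬝ᵥ s = ((d.2 : ℤ) : ℝ) * s d.1 := by
    simp
  rw [hdot, ← mul_pow, ← hL] at hpatch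
  have huni := sum_uniformMatching_patch s hs d k ⌊(ε * k + 1) / 2⌋₊ a b
  rw [← hqeven] at huni
  have hsd : |((d.2 : ℤ) : ℝ) * s d.1| ≤ 1 := by
    have h1 : |s d.1| ≤ 1 := le_trans
      (Finset.single_le_sum (f := fun i => |s i|) (fun i _ => abs_nonneg _) (Finset.mem_univ d.1)) hs
    rcases Int.units_eq_one_or d.2 with h | h <;> simpa [h] using h1
  simp only [fluxDifference, mul_sub, Finset.sum_sub_distrib]
  rw [huni]
  set T := ∑ a' ∈ Finset.Ico a (a + q), ∑ b' ∈ Finset.Ico b (b + q),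
    sgn (facePoint d.1 (d.2 * k) a' b') *
      τ.toFractional.weight (facePoint d.1 (d.2 * k) a' b') d with hT
  have hLq : |(q : ℝ) ^ 2 - L ^ 2| ≤ 2 * q + 1 := by
    rw [abs_le]
    constructor <;> nlinarith
  have hfirst : |1 / 2 * (((d.2 : ℤ) : ℝ) * s d.1) * ((q : ℝ) ^ 2 - L ^ 2)| ≤
      1 / 2 * (2 * (q : ℝ) + 1) := by
    rw [abs_mul, abs_mul, abs_of_pos (by norm_num : (0 : ℝ) < 1 / 2)]
    have := mul_le_mul hsd hLq (abs_nonneg _) zero_le_one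
    linarith
  have hL2 : L ^ 2 ≤ 4 * (q : ℝ) ^ 2 := by
    have : 0 ≤ L := by positivity
    nlinarith
  have hθq' : 6 * (q : ℝ) ≤ θ * q ^ 2 := by
    rw [div_le_iff₀ hθ] at hθq
    nlinarith
  have hsplit : 1 / 2 * (((d.2 : ℤ) : ℝ) * s d.1) * (q : ℝ) ^ 2 - T =
      1 / 2 * (((d.2 : ℤ) : ℝ) * s d.1) * ((q : ℝ) ^ 2 - L ^ 2) -
        (T - 1 / 2 * (((d.2 : ℤ) : ℝ) * s d.1) * L ^ 2) := by ring
  rw [hsplit]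
  refine (abs_sub _ _).trans ?_
  have := mul_le_mul_of_nonneg_left hL2 (by positivity : 0 ≤ θ / 8)
  linarith

/-! ### Hall's theorem -/

/-- Hall's condition for the points of sign `ς` of a region gives an injective choice of
neighbours. -/
theorem exists_injective_neighbor (R : Finset Vertex) (ς : ℝ)
    (h : ∀ U ⊆ R, (∀ u ∈ U, ς * sgn u = 1) →
      U.card ≤ (R.filter fun y => ∃ u ∈ U, cubicLattice.Adj u y).card) :
    ∃ f : {x // x ∈ R.filter fun x => ς * sgn x = 1} → Vertex, Function.Injective f ∧
      ∀ x, f x ∈ R ∧ cubicLattice.Adj x.1 (f x) := by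
  obtain ⟨f, hf, hf'⟩ := (Finset.all_card_le_biUnion_card_iff_exists_injective
    (fun x : {x // x ∈ R.filter fun x => ς * sgn x = 1} =>
      R.filter fun y => cubicLattice.Adj x.1 y)).1 (by
    intro s
    have hs : ∀ u ∈ s.map (Function.Embedding.subtype _), u ∈ R ∧ ς * sgn u = 1 := by
      intro u hu
      obtain ⟨x, -, rfl⟩ := Finset.mem_map.1 hu
      exact Finset.mem_filter.1 x.2
    have := h (s.map (Function.Embedding.subtype _)) (fun u hu => (hs u hu).1)
      fun u hu => (hs u hu).2
    rw [Finset.card_map] at this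
    refine this.trans (Finset.card_le_card fun y hy => ?_)
    obtain ⟨hy, u, hu, hadj⟩ := Finset.mem_filter.1 hy
    obtain ⟨x, hx, rfl⟩ := Finset.mem_map.1 hu
    exact Finset.mem_biUnion.2 ⟨x, hx, Finset.mem_filter.2 ⟨hy, hadj⟩⟩)
  exact ⟨f, hf, fun x => Finset.mem_filter.1 (hf' x)⟩

theorem sgn_eq_neg_of_adj {x y : Vertex} (h : cubicLattice.Adj x y) : sgn y = -sgn x := by
  obtain ⟨d, rfl⟩ := cubicLattice_adj_iff.1 h
  exact sgn_add_step x d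

/-- A finite region that satisfies Hall's condition for both parities is tileable. -/
theorem tileable_of_hall (R : Finset Vertex)
    (h : ∀ ς : ℝ, ς = 1 ∨ ς = -1 → ∀ U ⊆ R, (∀ u ∈ U, ς * sgn u = 1) →
      U.card ≤ (R.filter fun y => ∃ u ∈ U, cubicLattice.Adj u y).card) :
    Tileable (R : Set Vertex) := by
  obtain ⟨f, hf, hfR⟩ := exists_injective_neighbor R 1 (h 1 (Or.inl rfl))
  obtain ⟨g, hg, hgR⟩ := exists_injective_neighbor R (-1) (h (-1) (Or.inr rfl))
  have hfmem : ∀ x, f x ∈ R.filter fun x => -1 * sgn x = 1 := fun x =>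
    Finset.mem_filter.2 ⟨(hfR x).1, by
      have := (Finset.mem_filter.1 x.2).2
      rw [sgn_eq_neg_of_adj (hfR x).2]
      linarith⟩
  have hgmem : ∀ x, g x ∈ R.filter fun x => 1 * sgn x = 1 := fun x =>
    Finset.mem_filter.2 ⟨(hgR x).1, by
      have := (Finset.mem_filter.1 x.2).2
      rw [sgn_eq_neg_of_adj (hgR x).2]
      linarith⟩
  -- The Schröder–Bernstein bijection uses `f` or the inverse of `g` at each point, so it only pairs
  -- neighbours.
  obtain ⟨φ, hφ, hadj⟩ := Function.Embedding.schroeder_bernstein_of_rel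
    (f := fun x => (⟨f x, hfmem x⟩ : {x // x ∈ R.filter fun x => -1 * sgn x = 1}))
    (g := fun x => (⟨g x, hgmem x⟩ : {x // x ∈ R.filter fun x => 1 * sgn x = 1}))
    (fun x y hxy => hf (congrArg Subtype.val hxy)) (fun x y hxy => hg (congrArg Subtype.val hxy))
    (fun x y => cubicLattice.Adj x.1 y.1) (fun x => (hfR x).2) fun x => (hgR x).2.symm
  have hpos : ∀ x : {x // x ∈ R.filter fun x => 1 * sgn x = 1}, sgn x.1 = 1 := fun x => by
    simpa using (Finset.mem_filter.1 x.2).2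
  have hneg : ∀ x : {x // x ∈ R.filter fun x => -1 * sgn x = 1}, sgn x.1 = -1 := fun x => by
    have := (Finset.mem_filter.1 x.2).2
    linarith
  refine ⟨{
    verts := R
    Adj := fun x y => ∃ u, (x = u.1 ∧ y = (φ u).1) ∨ (y = u.1 ∧ x = (φ u).1)
    adj_sub := ?_
    edge_vert := ?_
    symm := ⟨fun x y ⟨u, hu⟩ => ⟨u, hu.symm⟩⟩ }, rfl, ?_⟩
  · rintro x y ⟨u, ⟨rfl, rfl⟩ | ⟨rfl, rfl⟩⟩
    exacts [hadj u, (hadj u).symm]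
  · rintro x y ⟨u, ⟨rfl, rfl⟩ | ⟨rfl, rfl⟩⟩
    exacts [(Finset.mem_filter.1 u.2).1, (Finset.mem_filter.1 (φ u).2).1]
  · intro x hx
    rcases sgn_eq_or x with hs | hs
    · refine ⟨(φ ⟨x, Finset.mem_filter.2 ⟨hx, by simpa using hs⟩⟩).1,
        ⟨_, Or.inl ⟨rfl, rfl⟩⟩, ?_⟩
      rintro y ⟨u, ⟨rfl, rfl⟩ | ⟨rfl, rfl⟩⟩
      · rfl
      · have := hneg (φ u)
        rw [hs] at this
        norm_num at this
    · obtain ⟨u, hu⟩ := hφ.2 ⟨x, Finset.mem_filter.2 ⟨hx, by rw [hs]; norm_num⟩⟩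
      have hux : (φ u).1 = x := congrArg Subtype.val hu
      refine ⟨u.1, ⟨u, Or.inr ⟨rfl, hux.symm⟩⟩, ?_⟩
      rintro y ⟨w, ⟨rfl, rfl⟩ | ⟨rfl, hw⟩⟩
      · have := hpos w
        rw [hs] at this
        norm_num at this
      · have : φ w = φ u := Subtype.ext (hw.symm.trans hux.symm)
        rw [hφ.1 this]

/-! ### The annulus and its Hall violator -/

theorem mem_box_iff {r : ℝ} {x : Vertex} : x ∈ box r ↔ (rad x : ℝ) ≤ r := by
  constructor
  · intro h
    obtain ⟨i, -, hi⟩ := Finset.exists_mem_eq_sup Finset.univ ⟨0, Finset.mem_univ 0⟩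
      fun i => (x i).natAbs
    have h' : rad x = (x i).natAbs := hi
    rw [h', Nat.cast_natAbs, Int.cast_abs]
    exact h i
  · intro h i
    refine le_trans ?_ h
    exact_mod_cast abs_le_rad x i

theorem rad_le_of_adj {x y : Vertex} (h : cubicLattice.Adj x y) : rad y ≤ rad x + 1 := by
  obtain ⟨d, rfl⟩ := cubicLattice_adj_iff.1 h
  exact rad_add_step_le x d

theorem adj_unique (τ : DimerTiling) {x y z : Vertex} (hy : τ.1.Adj x y) (hz : τ.1.Adj x z) :
    y = z :=
  (SimpleGraph.Subgraph.isPerfectMatching_iff.1 τ.2 x).unique hy hz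

section Annulus

variable {δ : ℝ} {n : ℕ} {τ₁ τ₂ : DimerTiling}

theorem mem_annulusWithBoundary_iff {x : Vertex} :
    x ∈ annulusWithBoundary δ n τ₁ τ₂ ↔ (rad x ≤ n ∧ (1 - δ) * n < rad x) ∧
      (∀ y, τ₁.1.Adj x y → rad y ≤ n) ∧ ∀ y, τ₂.1.Adj x y → (1 - δ) * n < rad y := by
  simp only [annulusWithBoundary, Set.mem_ofPred_eq, Set.mem_sdiff, mem_box_iff, not_le,
    Nat.cast_le]

theorem mem_annulus_of_interior {x : Vertex} (h1 : rad x + 1 ≤ n) (h2 : (1 - δ) * n + 1 < rad x) :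
    x ∈ annulusWithBoundary δ n τ₁ τ₂ := by
  refine mem_annulusWithBoundary_iff.2 ⟨⟨by omega, by linarith⟩, fun y hy => ?_, fun y hy => ?_⟩
  · exact (rad_le_of_adj hy.adj_sub).trans h1
  · have : (rad x : ℝ) ≤ rad y + 1 := by exact_mod_cast rad_le_of_adj hy.adj_sub.symm
    linarith

/-- The `τ₁`-partner of a point of the region cannot be removed by the outer condition, since its
own `τ₁`-partner is that point; far from the inner box it cannot be removed by the inner condition
either. -/
theorem mem_annulus_of_adj_outer {x y : Vertex} (hx : x ∈ annulusWithBoundary δ n τ₁ τ₂)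
    (hxy : τ₁.1.Adj x y) (hy : (1 - δ) * n + 1 < rad y) :
    y ∈ annulusWithBoundary δ n τ₁ τ₂ := by
  rw [mem_annulusWithBoundary_iff] at hx
  refine mem_annulusWithBoundary_iff.2 ⟨⟨hx.2.1 y hxy, by linarith⟩, fun z hz => ?_,
    fun z hz => ?_⟩
  · rw [← adj_unique τ₁ hxy.symm hz]
    exact hx.1.1
  · have : (rad y : ℝ) ≤ rad z + 1 := by exact_mod_cast rad_le_of_adj hz.adj_sub.symm
    linarith

theorem mem_annulus_of_adj_inner {x y : Vertex} (hx : x ∈ annulusWithBoundary δ n τ₁ τ₂)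
    (hxy : τ₂.1.Adj x y) (hy : rad y + 1 ≤ n) :
    y ∈ annulusWithBoundary δ n τ₁ τ₂ := by
  rw [mem_annulusWithBoundary_iff] at hx
  refine mem_annulusWithBoundary_iff.2 ⟨⟨by omega, hx.2.2 y hxy⟩, fun z hz => ?_, fun z hz => ?_⟩
  · exact (rad_le_of_adj hz.adj_sub).trans hy
  · rw [← adj_unique τ₂ hxy.symm hz]
    exact hx.1.2

/-- If the annulus violates Hall's condition, then there is a set `V` that violates all the
comparison estimates. -/
theorem exists_imbalanced_set (h : ¬ Tileable (annulusWithBoundary δ n τ₁ τ₂)) :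
    ∃ V : Finset Vertex, ∀ (w : FractionalMatching) (c : ℝ), 0 ≤ c → (∀ x d, c ≤ w.weight x d) →
      ∀ kin kout : ℕ, (1 - δ) * n < kin → kin < kout → kout < n →
        1 + c * ∑ κ ∈ Finset.Ioc kin kout, ((shellBoundary V κ).card : ℝ) ≤
          |crossingSum V kout kout (fluxDifference w τ₁.toFractional kout)| +
            |crossingSum V kin (kin + 1) (fluxDifference w τ₂.toFractional kin)| := by
  set R : Finset Vertex := (ball n).filter (· ∈ annulusWithBoundary δ n τ₁ τ₂) with hR
  have hmemR : ∀ x, x ∈ R ↔ x ∈ annulusWithBoundary δ n τ₁ τ₂ := by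
    intro x
    rw [hR, Finset.mem_filter, mem_ball, and_iff_right_iff_imp]
    exact fun hx => (mem_annulusWithBoundary_iff.1 hx).1.1
  have hRset : (R : Set Vertex) = annulusWithBoundary δ n τ₁ τ₂ := Set.ext hmemR
  rw [← hRset] at h
  have hviol := mt (tileable_of_hall R) h
  push Not at hviol
  obtain ⟨ς, hς, U, hUR, hU, hcard⟩ := hviol
  set N := R.filter fun y => ∃ u ∈ U, cubicLattice.Adj u y with hN
  have hNsgn : ∀ y ∈ N, ς * sgn y = -1 := by
    intro y hy
    obtain ⟨-, u, hu, hadj⟩ := Finset.mem_filter.1 hy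
    rw [sgn_eq_neg_of_adj hadj, mul_neg, hU u hu]
  have hdisj : Disjoint U N := by
    refine Finset.disjoint_left.2 fun x hx hx' => ?_
    have h1 := hU x hx
    rw [hNsgn x hx'] at h1
    norm_num at h1
  have hexp : ∀ x ∈ U ∪ N, ς * sgn x = 1 → x ∈ U := by
    intro x hx hs
    rcases Finset.mem_union.1 hx with hx | hx
    · exact hx
    · rw [hNsgn x hx] at hs
      norm_num at hs
  have hclosed : ∀ x ∈ U ∪ N, ς * sgn x = 1 → ∀ d,
      x + step d ∈ annulusWithBoundary δ n τ₁ τ₂ → x + step d ∈ U ∪ N := by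
    intro x hx hs d hd
    exact Finset.mem_union_right _ (Finset.mem_filter.2 ⟨(hmemR _).2 hd, x, hexp x hx hs,
      cubicLattice_adj_iff.2 ⟨d, rfl⟩⟩)
  have hann : ∀ x ∈ U ∪ N, ς * sgn x = 1 → x ∈ annulusWithBoundary δ n τ₁ τ₂ :=
    fun x hx hs => (hmemR x).1 (hUR (hexp x hx hs))
  have hadj : ∀ (τ : DimerTiling) (x : Vertex) (d : Dir), τ.toFractional.weight x d ≠ 0 →
      τ.1.Adj x (x + step d) := by
    intro τ x d hne
    by_contra hcon
    exact hne (if_neg hcon)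
  -- One set `V` serves all `w`, `kin` and `kout`, which is what allows the annulus to be widened
  -- later.
  refine ⟨U ∪ N, fun w c hc hw kin kout hkin hk hkout => ?_⟩
  have hsum : ς * ∑ x ∈ U ∪ N, sgn x = U.card - N.card := by
    rw [Finset.mul_sum, Finset.sum_union hdisj, Finset.sum_congr rfl hU,
      Finset.sum_congr rfl hNsgn]
    simp
    ring
  -- The Hall deficit is a positive integer.
  have hD : (1 : ℝ) ≤ ς * ∑ x ∈ U ∪ N, sgn x := by
    rw [hsum]
    have : (N.card : ℝ) + 1 ≤ U.card := by exact_mod_cast hcard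
    linarith
  refine le_trans (add_le_add_left hD _) (imbalance_le (U ∪ N) hς w τ₁.toFractional
    τ₂.toFractional hc hw hk ?_ ?_ ?_)
  · intro x hx hs d _ _ h3 h4
    refine hclosed x hx hs d (mem_annulus_of_interior (by omega) ?_)
    have : (kin : ℝ) + 1 ≤ rad (x + step d) := by exact_mod_cast h3
    linarith
  · intro x hx hs d h1 h2
    refine hclosed x hx hs d (mem_annulus_of_adj_outer (hann x hx hs) (hadj τ₁ x d h2) ?_)
    have h3 := rad_le_add_step x d
    have : (kin : ℝ) + 1 ≤ rad (x + step d) := by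
      have : kin + 1 ≤ rad (x + step d) := by omega
      exact_mod_cast this
    linarith
  · intro x hx hs d h1 h2
    refine hclosed x hx hs d (mem_annulus_of_adj_inner (hann x hx hs) (hadj τ₂ x d h2) ?_)
    have h3 := rad_add_step_le x d
    omega

end Annulus

/-! ### Growth of the boundary -/

/-- A summation process whose increments dominate the square root of its value grows
quadratically. -/
theorem quadratic_growth {G p : ℕ → ℝ} {c D : ℝ} {J : ℕ} (hc : 0 < c) (hD : 0 < D) (hG0 : G 0 = 0)
    (hG : ∀ j < J, G (j + 1) = G j + p j) (hp : ∀ j, 0 ≤ p j)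
    (hB : ∀ j < J, D + c * G (j + 1) ≤ 6 * p j ^ 2) :
    ∀ j ≤ J, 0 ≤ G j ∧ √(c / 24) * j ≤ √(G j) := by
  intro j
  induction j with
  | zero => simp [hG0]
  | succ j ih =>
    intro hj
    obtain ⟨h0, h1⟩ := ih (by omega)
    have hstep := hG j (by omega)
    have hsq := hB j (by omega)
    have hpj := hp j
    have h0' : 0 ≤ G (j + 1) := by linarith
    refine ⟨h0', ?_⟩
    set a := √(G j)
    set b := √(G (j + 1))
    have ha : a ^ 2 = G j := Real.sq_sqrt h0
    have hb : b ^ 2 = G (j + 1) := Real.sq_sqrt h0'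
    have ha0 : 0 ≤ a := Real.sqrt_nonneg _
    have hb0 : 0 ≤ b := Real.sqrt_nonneg _
    have hab : a ≤ b := Real.sqrt_le_sqrt (by linarith)
    -- With `p j ≤ (b - a) * 2b` the hypothesis `c * b² ≤ 6 * (p j)²` becomes `c ≤ 24 * (b - a)²`.
    -- Positivity of `D` keeps `G` from staying at zero, so `b²` can be cancelled.
    have hpab : p j = (b - a) * (b + a) := by linear_combination ha - hb - hstep
    have hppos : 0 < p j := by
      rcases hpj.lt_or_eq with h | h
      · exact h
      · rw [← h] at hsq
        have := mul_nonneg hc.le h0'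
        nlinarith
    have hbpos : 0 < b := by
      rcases hb0.lt_or_eq with h | h
      · exact h
      · have : a = 0 := le_antisymm (by rw [h]; exact hab) ha0
        rw [hpab, ← h, this] at hppos
        norm_num at hppos
    have hkey : c ≤ 24 * (b - a) ^ 2 := by
      have h2 : (b + a) ^ 2 ≤ (2 * b) ^ 2 := by gcongr; linarith
      have h3 := mul_le_mul_of_nonneg_left h2 (sq_nonneg (b - a))
      have h4 : c * b ^ 2 ≤ 24 * (b - a) ^ 2 * b ^ 2 := by
        rw [hb]
        calc c * G (j + 1) ≤ 6 * p j ^ 2 := by linarith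
          _ = 6 * ((b - a) ^ 2 * (b + a) ^ 2) := by rw [hpab]; ring
          _ ≤ 6 * ((b - a) ^ 2 * (2 * b) ^ 2) := by linarith
          _ = 24 * (b - a) ^ 2 * G (j + 1) := by rw [← hb]; ring
      exact le_of_mul_le_mul_right h4 (by positivity)
    have : √(c / 24) ≤ b - a := by
      refine Real.sqrt_le_iff.2 ⟨by linarith, by linarith⟩
    push_cast
    linarith

/-- Lower and upper growth bounds combined. -/
theorem growth_bound {G p : ℕ → ℝ} {c D A a b : ℝ} {J : ℕ} (hc : 0 < c) (hD : 0 < D) (hJ : 0 < J)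
    (hb : 0 ≤ b) (hG0 : G 0 = 0) (hG : ∀ j < 2 * J, G (j + 1) = G j + p j) (hp : ∀ j, 0 ≤ p j)
    (hA : ∀ j < 2 * J, D + c * G (j + 1) ≤ A)
    (hB : ∀ j < 2 * J, D + c * G (j + 1) ≤ 6 * p j ^ 2)
    (hC : ∀ j < 2 * J, D + c * G (j + 1) ≤ a + b * p j) :
    c ^ 2 / 24 * J ^ 2 ≤ a + b * (A / (c * J)) := by
  have hgrow := quadratic_growth hc hD hG0 hG hp hB
  have hJ' : (0 : ℝ) < J := by exact_mod_cast hJ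
  have hGJ : c / 24 * J ^ 2 ≤ G J := by
    obtain ⟨h0, h1⟩ := hgrow J (by omega)
    have h2 : (√(c / 24) * J) ^ 2 ≤ √(G J) ^ 2 := by gcongr
    rwa [mul_pow, Real.sq_sqrt h0, Real.sq_sqrt (by positivity)] at h2
  have htel : ∀ m ≤ J, G (J + m) = G J + ∑ i ∈ Finset.range m, p (J + i) := by
    intro m
    induction m with
    | zero => simp
    | succ m ih =>
      intro hm
      rw [Finset.sum_range_succ, ← add_assoc, hG _ (by omega), ih (by omega), add_assoc]
  have hmono : ∀ m ≤ J, G J ≤ G (J + m) := fun m hm => by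
    rw [htel m hm]
    exact le_add_of_nonneg_right (Finset.sum_nonneg fun _ _ => hp _)
  -- Pigeonhole on the steps from `J` to `2J`: if all increments were larger, `c * G (2J)` would
  -- exceed the cap `A`.
  obtain ⟨m, hm, hpm⟩ : ∃ m < J, p (J + m) ≤ A / (c * J) := by
    by_contra! hcon
    have h1 : ∑ _i ∈ Finset.range J, A / (c * J) ≤ ∑ i ∈ Finset.range J, p (J + i) :=
      Finset.sum_le_sum fun i hi => (hcon i (Finset.mem_range.1 hi)).le
    rw [Finset.sum_const, Finset.card_range, nsmul_eq_mul] at h1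
    have h2 := htel J le_rfl
    have h3 := hA (J + J - 1) (by omega)
    rw [show J + J - 1 + 1 = J + J by omega] at h3
    have h4 : (J : ℝ) * (A / (c * J)) = A / c := by field_simp
    have h5 : 0 < G J := lt_of_lt_of_le (by positivity) hGJ
    have h6 : A / c ≤ G (J + J) := by linarith
    rw [div_le_iff₀ hc] at h6
    linarith
  have h1 := hC (J + m) (by omega)
  have h2 := hmono (m + 1) hm
  rw [← add_assoc] at h2
  have h3 := mul_le_mul_of_nonneg_left hpm hb
  have h4 := mul_le_mul_of_nonneg_left (hGJ.trans h2) hc.le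
  calc c ^ 2 / 24 * J ^ 2 = c * (c / 24 * J ^ 2) := by ring
    _ ≤ c * G (J + m + 1) := h4
    _ ≤ _ := by linarith

/-! ### Choice of constants and conclusion -/

/-- The patch estimate for a ball of radius at most `n`, in terms of `n`. -/
theorem abs_crossingSum_le_linear {ε : ℝ} (hε : 0 < ε) {n k κ : ℕ} (hkn : k < n) (hkκ : k ≤ κ)
    (hn : 1 ≤ ε * n) (V : Finset Vertex) (w f : FractionalMatching) (hq : 0 < patchSide ε k)
    (hpatch : ∀ (d : Dir) (a b : ℤ),
      -(k : ℤ) < a → a + patchSide ε k ≤ k → -(k : ℤ) < b → b + patchSide ε k ≤ k →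
      |∑ a' ∈ Finset.Ico a (a + patchSide ε k), ∑ b' ∈ Finset.Ico b (b + patchSide ε k),
        fluxDifference w f k d a' b'| ≤ ε * (patchSide ε k : ℝ) ^ 2) :
    |crossingSum V k κ (fluxDifference w f k)| ≤
      234 * ε * n ^ 2 + 24 * ε * n * (shellBoundary V κ).card := by
  refine (abs_crossingSum_le_patches V hkκ hq hε.le _ (abs_fluxDifference_le w f k) hpatch).trans ?_
  have hkn' : (k : ℝ) + 1 ≤ n := by exact_mod_cast hkn
  have hk0 : (0 : ℝ) ≤ k := by positivity
  have hq1 : (patchSide ε k : ℝ) ≤ 2 * (ε * n) := by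
    have h1 := patchSide_le hε k
    have h2 : ε * k ≤ ε * n := mul_le_mul_of_nonneg_left (by linarith) hε.le
    linarith
  have h1 : ε * (2 * k + 1) ^ 2 ≤ ε * (9 * n ^ 2) := by
    refine mul_le_mul_of_nonneg_left ?_ hε.le
    nlinarith
  have h2 : 2 * (patchSide ε k : ℝ) * (shellBoundary V κ).card ≤
      4 * (ε * n) * (shellBoundary V κ).card := by
    refine mul_le_mul_of_nonneg_right ?_ (by positivity)
    linarith
  have h3 : 2 * (2 * (k : ℝ) + 1) * (2 * patchSide ε k + 1) ≤ 2 * (3 * n) * (5 * (ε * n)) := by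
    refine mul_le_mul ?_ ?_ (by positivity) (by positivity) <;> linarith
  nlinarith

/-- The two new shells are the outermost, `kout`, and the innermost, `kin + 1`: exactly those in
which the crossing sums read `V`. So the perimeter in the mismatch bounds is the increment of `G`.
-/
theorem sum_Ioc_symm_succ (F : ℕ → ℝ) {K j : ℕ} (hj : j < K) :
    ∑ κ ∈ Finset.Ioc (K - (j + 1)) (K + (j + 1)), F κ =
      ∑ κ ∈ Finset.Ioc (K - j) (K + j), F κ + (F (K + (j + 1)) + F (K - (j + 1) + 1)) := by
  have e1 : Finset.Ioc (K - (j + 1)) (K + (j + 1)) =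
      insert (K + (j + 1)) (insert (K - (j + 1) + 1) (Finset.Ioc (K - j) (K + j))) := by
    ext m
    simp only [Finset.mem_Ioc, Finset.mem_insert]
    omega
  rw [e1, Finset.sum_insert, Finset.sum_insert]
  · ring
  · simp only [Finset.mem_Ioc]
    omega
  · simp only [Finset.mem_Ioc, Finset.mem_insert]
    omega

/-- An interior point can be scaled by some factor larger than one without leaving the octahedron.
-/
theorem sum_abs_lt_one_of_mem_interior {s : Fin 3 → ℝ} (hs : s ∈ interior meanCurrentOctahedron) :
    ∑ i, |s i| < 1 := by
  have hcont : ContinuousAt (fun t : ℝ => t • s) 1 := by fun_prop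
  have hmem : ∀ᶠ t : ℝ in nhds 1, t • s ∈ meanCurrentOctahedron := by
    refine hcont.eventually_mem (mem_interior_iff_mem_nhds.1 ?_)
    simpa using hs
  obtain ⟨r, hr, hball⟩ := Metric.eventually_nhds_iff.1 hmem
  have h := hball (y := 1 + r / 2) (by
    rw [Real.dist_eq, add_sub_cancel_left, abs_of_pos (by positivity)]
    linarith)
  have h' : ∑ i, |(1 + r / 2) * s i| ≤ 1 := h
  simp only [abs_mul, ← Finset.mul_sum] at h'
  rw [abs_of_pos (by positivity : 0 < 1 + r / 2)] at h'
  have h0 : 0 ≤ ∑ i, |s i| := Finset.sum_nonneg fun _ _ => abs_nonneg _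
  nlinarith

/-- The annulus between radii `K - 2J` and `K + 2J` is too thick for a set that violates Hall's
condition. -/
theorem tileable_of_thick_annulus {δ ε : ℝ} (hε : 0 < ε) {s : Fin 3 → ℝ} (hs : ∑ i, |s i| < 1)
    {τ₁ τ₂ : DimerTiling} {n K J : ℕ} (hJ : 0 < J) (hK : 2 * J ≤ K)
    (hin : (1 - δ) * n < (K - 2 * J : ℕ)) (hout : K + 2 * J < n) (hn : 1 ≤ ε * n)
    (hpatch : ∀ τ ∈ ({τ₁, τ₂} : Set DimerTiling), ∀ k, K - 2 * J ≤ k → 0 < patchSide ε k ∧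
      ∀ (d : Dir) (a b : ℤ),
      -(k : ℤ) < a → a + patchSide ε k ≤ k → -(k : ℤ) < b → b + patchSide ε k ≤ k →
      |∑ a' ∈ Finset.Ico a (a + patchSide ε k), ∑ b' ∈ Finset.Ico b (b + patchSide ε k),
        fluxDifference (uniformMatching s hs.le) τ.toFractional k d a' b'| ≤
        ε * (patchSide ε k : ℝ) ^ 2)
    (hbig : 468 * ε * n ^ 2 + 24 * ε * n * (108 * n ^ 2 / ((1 - ∑ i, |s i|) / 6 * J)) <
      ((1 - ∑ i, |s i|) / 6) ^ 2 / 24 * J ^ 2) :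
    Tileable (annulusWithBoundary δ n τ₁ τ₂) := by
  by_contra hcon
  obtain ⟨V, hV⟩ := exists_imbalanced_set hcon
  set w := uniformMatching s hs.le
  set c := (1 - ∑ i, |s i|) / 6 with hcdef
  have hc : 0 < c := by
    rw [hcdef]
    linarith
  have hV' := hV w c hc.le (le_uniformMatching_weight s hs.le)
  set P : ℕ → ℝ := fun κ => (shellBoundary V κ).card with hP
  have hP0 : ∀ κ, 0 ≤ P κ := fun κ => by positivity
  have hmain : ∀ j < 2 * J, 1 + c * ∑ κ ∈ Finset.Ioc (K - (j + 1)) (K + (j + 1)), P κ ≤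
      |crossingSum V (K + (j + 1)) (K + (j + 1)) (fluxDifference w τ₁.toFractional (K + (j + 1)))| +
      |crossingSum V (K - (j + 1)) (K - (j + 1) + 1)
        (fluxDifference w τ₂.toFractional (K - (j + 1)))| := by
    intro j hj
    refine hV' _ _ (hin.trans_le ?_) (by omega) (by omega)
    exact_mod_cast (by omega : K - 2 * J ≤ K - (j + 1))
  have hcube : ∀ k : ℕ, k < n → 6 * (2 * (k : ℝ) + 1) ^ 2 ≤ 54 * n ^ 2 := by
    intro k hk
    have : (k : ℝ) + 1 ≤ n := by exact_mod_cast hk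
    have h0 : (0 : ℝ) ≤ k := by positivity
    nlinarith
  -- `D` is the Hall deficit; `A` and `a` are twice the one-sphere constants `54` and `234`, one for
  -- each bounding sphere.
  refine absurd (growth_bound (D := 1) (A := 108 * n ^ 2) (a := 468 * ε * n ^ 2)
    (b := 24 * ε * n) (c := c) (J := J)
    (G := fun j => ∑ κ ∈ Finset.Ioc (K - j) (K + j), P κ)
    (p := fun j => P (K + (j + 1)) + P (K - (j + 1) + 1)) hc one_pos hJ (by positivity) (by simp)
    (fun j hj => sum_Ioc_symm_succ P (by omega)) (fun j => add_nonneg (hP0 _) (hP0 _))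
    (fun j hj => ?_) (fun j hj => ?_) fun j hj => ?_) (not_le.2 hbig)
  · have h1 := abs_crossingSum_le_card V (K + (j + 1)) (K + (j + 1)) _
      (abs_fluxDifference_le w τ₁.toFractional (K + (j + 1)))
    have h2 := abs_crossingSum_le_card V (K - (j + 1)) (K - (j + 1) + 1) _
      (abs_fluxDifference_le w τ₂.toFractional (K - (j + 1)))
    have h3 := hcube (K + (j + 1)) (by omega)
    have h4 := hcube (K - (j + 1)) (by omega)
    have h5 := hmain j hj
    linarith
  · have h1 := abs_crossingSum_le_sq V (le_refl (K + (j + 1))) _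
      (abs_fluxDifference_le w τ₁.toFractional _) (sum_fluxDifference w τ₁.toFractional _)
    have h2 := abs_crossingSum_le_sq V (Nat.le_succ (K - (j + 1))) _
      (abs_fluxDifference_le w τ₂.toFractional _) (sum_fluxDifference w τ₂.toFractional _)
    have h5 := hmain j hj
    have h6 := mul_nonneg (hP0 (K + (j + 1))) (hP0 (K - (j + 1) + 1))
    simp only [hP] at h5 h6 ⊢
    nlinarith
  · obtain ⟨hq1, hp1⟩ := hpatch τ₁ (by simp) (K + (j + 1)) (by omega)
    obtain ⟨hq2, hp2⟩ := hpatch τ₂ (by simp) (K - (j + 1)) (by omega)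
    have h1 := abs_crossingSum_le_linear hε (n := n) (by omega) (le_refl (K + (j + 1))) hn V w
      τ₁.toFractional hq1 hp1
    have h2 := abs_crossingSum_le_linear hε (n := n) (by omega) (Nat.le_succ (K - (j + 1))) hn V w
      τ₂.toFractional hq2 hp2
    have h5 := hmain j hj
    simp only [hP] at h5 ⊢
    linarith

end

end Dimer

theorem mainTheorem7 (δ : ℝ) (hδ : 0 < δ) (s : Fin 3 → ℝ)
    (hs : s ∈ interior Dimer.meanCurrentOctahedron) :
    ∃ ε₀ : ℝ, 0 < ε₀ ∧ ∀ ε : ℝ, 0 < ε → ε < ε₀ →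
      ∀ τ₁ τ₂ : Dimer.DimerTiling,
        Dimer.NearlyConstant ε s τ₁ → Dimer.NearlyConstant ε s τ₂ →
          ∃ N : ℕ, ∀ n : ℕ, N ≤ n →
            Dimer.Tileable (Dimer.annulusWithBoundary δ n τ₁ τ₂) := by
  have hs' := Dimer.sum_abs_lt_one_of_mem_interior hs
  set c := (1 - ∑ i, |s i|) / 6 with hcdef
  have hc : 0 < c := by
    rw [hcdef]
    linarith
  -- A thinner annulus suffices, and `ρ ≤ 1 / 2` keeps the inner radius of order `n` even when `δ`
  -- is large.
  set ρ := min δ (1 / 2) with hρ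
  have hρ0 : 0 < ρ := lt_min hδ (by norm_num)
  have hρδ : ρ ≤ δ := min_le_left _ _
  have hρ2 : ρ ≤ 1 / 2 := min_le_right _ _
  set β := ρ / 16 with hβ
  have hβ0 : 0 < β := by positivity
  -- The threshold at which `hbig` still holds with `J` replaced by its lower bound `β * n`; the
  -- powers of `n` cancel.
  refine ⟨c ^ 2 / 24 * β ^ 2 / (468 + 24 * (108 / (c * β))), by positivity,
    fun ε hε hεlt τ₁ τ₂ h₁ h₂ => ?_⟩
  rw [lt_div_iff₀ (by positivity)] at hεlt
  obtain ⟨K₁, hK₁⟩ := h₁.exists_patch_bound hε hs'.le hε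
  obtain ⟨K₂, hK₂⟩ := h₂.exists_patch_bound hε hs'.le hε
  obtain ⟨N, hN⟩ := exists_nat_ge (16 / ρ + 1 / ε + 4 * (K₁ + K₂) + 4)
  refine ⟨N, fun n hn => ?_⟩
  have hn' : 16 / ρ + 1 / ε + 4 * (K₁ + K₂) + 4 ≤ (n : ℝ) := hN.trans (by exact_mod_cast hn)
  have e1 : 0 < 16 / ρ := by positivity
  have e2 : 0 < 1 / ε := by positivity
  have e3 : (0 : ℝ) ≤ K₁ := by positivity
  have e4 : (0 : ℝ) ≤ K₂ := by positivity
  have hn0 : (0 : ℝ) < n := by linarith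
  have hρn : 16 ≤ ρ * n := by
    have : 16 / ρ ≤ n := by linarith
    rw [div_le_iff₀ hρ0] at this
    linarith
  have hεn : 1 ≤ ε * n := by
    have : 1 / ε ≤ n := by linarith
    rw [div_le_iff₀ hε] at this
    linarith
  -- With `J` near `ρ n / 8` and `K` near `(1 - ρ / 2) n`, the radii `K ± 2J` keep a margin of about
  -- `ρ n / 4` from `(1 - ρ) n` and from `n`, enough for the rounding.
  obtain ⟨J, hJ1, hJ2⟩ : ∃ J : ℕ, (J : ℝ) ≤ ρ * n / 8 ∧ ρ * n / 8 < J + 1 :=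
    ⟨_, Nat.floor_le (by positivity), Nat.lt_floor_add_one _⟩
  obtain ⟨K, hK1, hK2⟩ : ∃ K : ℕ, (K : ℝ) ≤ (1 - ρ / 2) * n ∧ (1 - ρ / 2) * n < K + 1 :=
    ⟨_, Nat.floor_le (mul_nonneg (by linarith) hn0.le), Nat.lt_floor_add_one _⟩
  have hρn2 : ρ * n ≤ 1 / 2 * n := mul_le_mul_of_nonneg_right hρ2 hn0.le
  have hβJ : β * n ≤ J := by
    rw [hβ]
    linarith
  have hJ0 : (0 : ℝ) < J := lt_of_lt_of_le (by positivity) hβJ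
  have hKJ : 2 * J ≤ K := by
    have : (2 * J : ℝ) ≤ K := by nlinarith
    exact_mod_cast this
  have hKJcast : ((K - 2 * J : ℕ) : ℝ) = K - 2 * J := by
    rw [Nat.cast_sub hKJ]
    push_cast
    ring
  have hlarge : (K₁ : ℝ) + K₂ ≤ (K - 2 * J : ℕ) := by
    rw [hKJcast]
    nlinarith
  have hlarge' : K₁ + K₂ ≤ K - 2 * J := by exact_mod_cast hlarge
  refine Dimer.tileable_of_thick_annulus hε hs' (K := K) (J := J) (by exact_mod_cast hJ0) hKJ ?_ ?_
    hεn ?_ ?_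
  · rw [hKJcast]
    have : (1 - δ) * n ≤ (1 - ρ) * n := mul_le_mul_of_nonneg_right (by linarith) hn0.le
    nlinarith
  · have : (K : ℝ) + 2 * J < n := by nlinarith
    exact_mod_cast this
  · rintro τ (rfl | rfl) k hk
    · exact hK₁ k (by omega)
    · exact hK₂ k (by omega)
  · rw [← hcdef]
    have h1 : 108 * (n : ℝ) ^ 2 / (c * J) ≤ 108 / (c * β) * n := by
      have : 108 / (c * β) * (n : ℝ) = 108 * n ^ 2 / (c * (β * n)) := by
        field_simp
      rw [this]
      gcongr
    have h2 : c ^ 2 / 24 * (β * n) ^ 2 ≤ c ^ 2 / 24 * (J : ℝ) ^ 2 := by gcongr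
    calc _ ≤ 468 * ε * n ^ 2 + 24 * ε * n * (108 / (c * β) * n) := by gcongr
      _ = ε * (468 + 24 * (108 / (c * β))) * n ^ 2 := by ring
      _ < c ^ 2 / 24 * β ^ 2 * n ^ 2 := by gcongr
      _ = c ^ 2 / 24 * (β * n) ^ 2 := by ring
      _ ≤ _ := h2
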